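/- Fix an integer $k\ge 2$, a length $L>0$ and a base $B>1$. **Good distributions.** For $x\in[0,1]^{k-1}$ let $\mathrm{rk}_i(x)$ be its $i$-th smallest coordinate ($1\le i\le k-1$), and put $\mathrm{rk}_0(x)=0$, $\mathrm{rk}_k(x)=1$. A probability distribution $\mathcal D$ on $[0,1]^{k-1}$ is *good* if for $X\sim\mathcal D$ and every $0\le i\le k-1$ the gap $\mathrm{rk}_{i+1}(X)-\mathrm{rk}_i(X)$ has a density on $[0,1]$ that is Hölder continuous on $[0,1]$ with some exponent in $(0,1]$. Fix a good distribution $\mathcal D$. **The process.** Start with $R$ living sticks of length $L$. At each level every living stick breaks into $k$ pieces, cut at the $k-1$ coordinates (as proportions of its length) of a random variable with law $\mathcal D$. Each new stick is then declared alive with probability $r=1/k$ and dead with probability $1-1/k$. Dead sticks never break again. All cut-point vectors and all alive/dead statuses are mutually independent. The ending sticks are the dead sticks. **Benford behavior.** For $x>0$ let $S_B(x)=x\,B^{-\lfloor\log_B x\rfloor}\in[1,B)$ be the significand of $x$. For a finite collection of positive numbers let $P(s)$ be the proportion (with multiplicity) of its members with significand in $[1,s]$. A sequence of finite collections of positive numbers,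 with proportions $P_n(s)$, *converges to strong Benford behavior (base $B$)* if $P_n(s)\to\log_B s$ for all $s\in[1,B)$. **Theorem.** For each $R$, the process started from $R$ sticks almost surely ends in finitely many levels, that is, after some level there is no living stick. Moreover, let the processes for $R=0,1,2,\dots$ be defined on one probability space, with arbitrary joint dependence between different values of $R$. Then almost surely the collections of ending stick lengths are finite, consist of positive numbers, and converge to strong Benford behavior base $B$ as $R\to\infty$. Also, with $P_R(s)$ the (random) proportion of ending sticks with significand in $[1,s]$, we have $\mathbb E[P_R(s)]\to\log_B s$ and $\operatorname{Var}[P_R(s)]\to 0$ as $R\to\infty$ for every $s\in[1,B)$. -/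

import Mathlib

open MeasureTheory ProbabilityTheory Filter Topology
open scoped NNReal ENNReal

namespace StickFragmentation

noncomputable section

/-! ### Benford behavior -/

/-- The significand `S_B(x) = x / B ^ ⌊log_B x⌋`; for `B > 1` and `x > 0` it lies in `[1, B)`. -/
def significand (B x : ℝ) : ℝ := x / B ^ ⌊Real.logb B x⌋

/-- The proportion of members of the finite indexed collection `a` (counted with multiplicity)
whose significand base `B` lies in `[1, s]`. -/
def significandProportion (B s : ℝ) {ι : Type*} (a : ι → ℝ) : ℝ :=
  (Nat.card {i : ι // 1 ≤ significand B (a i) ∧ significand B (a i) ≤ s} : ℝ) / (Nat.card ι : ℝ)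

/-- A sequence of finite collections of positive numbers converges to strong Benford behavior
base `B`. Finiteness and positivity are part of the assertion. -/
structure ConvergesToStrongBenford (B : ℝ) {ι : ℕ → Type*} (a : ∀ n, ι n → ℝ) : Prop where
  finite : ∀ n, Finite (ι n)
  pos : ∀ n i, 0 < a n i
  tendsto : ∀ s ∈ Set.Ico 1 B,
    Tendsto (fun n => significandProportion B s (a n)) atTop (𝓝 (Real.logb B s))

/-- A sequence of random collections `X n` (with random index sets `ι n ω`) converges to strong
Benford behavior base `B` in the sense of means and variances: `𝔼[P_n(s)] → log_B s` and
`Var[P_n(s)] → 0`, where `P_n(s)` is the proportion with significand at most `s`. -/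
structure ConvergesToStrongBenfordInMean (B : ℝ) {Ω : Type*} [MeasurableSpace Ω] (μ : Measure Ω)
    {ι : ℕ → Ω → Type*} (X : ∀ n ω, ι n ω → ℝ) : Prop where
  mean : ∀ s ∈ Set.Ico 1 B,
    Tendsto (fun n => ∫ ω, significandProportion B s (X n ω) ∂μ) atTop (𝓝 (Real.logb B s))
  variance : ∀ s ∈ Set.Ico 1 B,
    Tendsto (fun n => variance (fun ω => significandProportion B s (X n ω)) μ) atTop (𝓝 0)

/-! ### Good distributions of cut points -/

/-- `orderStat x i` is the `i`-th smallest coordinate of `x` for `1 ≤ i ≤ m`, with the conventions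
that the `0`-th one is `0` and the `(m + 1)`-st one is `1`. -/
def orderStat {m : ℕ} (x : Fin m → ℝ) : ℕ → ℝ
  | 0 => 0
  | i + 1 => if h : i < m then x (Tuple.sort x ⟨i, h⟩) else 1

/-- The distance between the `i`-th and the `(i + 1)`-st smallest coordinates, `0 ≤ i ≤ m`:
the `i`-th piece, from left to right, of `[0, 1]` cut at the coordinates of `x`. -/
def gap {m : ℕ} (x : Fin m → ℝ) (i : ℕ) : ℝ := orderStat x (i + 1) - orderStat x i

/-- A good distribution: a probability measure carried by `[0, 1]^m` for which each of the `m + 1`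
gaps has a Hölder continuous density on `[0, 1]`. -/
structure IsGood {m : ℕ} (D : Measure (Fin m → ℝ)) : Prop where
  isProbabilityMeasure : IsProbabilityMeasure D
  support : ∀ᵐ x ∂D, ∀ j, x j ∈ Set.Icc (0 : ℝ) 1
  density : ∀ i ≤ m, ∃ (C α : ℝ≥0) (f : ℝ → ℝ), 0 < α ∧ α ≤ 1 ∧
    HolderOnWith C α f (Set.Icc 0 1) ∧ (∀ t ∈ Set.Icc (0 : ℝ) 1, 0 ≤ f t) ∧
    D.map (fun x => gap x i) =
      (volume.restrict (Set.Icc (0 : ℝ) 1)).withDensity (fun t => ENNReal.ofReal (f t))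

/-! ### The fragmentation process

The descendants of one initial stick are addressed by lists: `[]` is the initial stick, and
`j :: u` is the `j`-th piece of the stick `u`. Its level is the length of the list.
`c u` are the relative cut points that the stick `u` uses if it breaks, and `a u` is the status
(`true`: alive) given to the stick `u` when it is created. -/

/-- The length of the stick with a given address, the initial stick having length `L`. -/
def stickLength {k : ℕ} (L : ℝ) (c : List (Fin k) → (Fin (k - 1) → ℝ)) : List (Fin k) → ℝ
  | [] => L
  | j :: u => stickLength L c u * gap (c u) j

/-- The stick with the given address comes into existence and is alive.
The initial stick is alive. -/
def IsAlive {k : ℕ} (a : List (Fin k) → Bool) : List (Fin k) → Prop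
  | [] => True
  | j :: u => IsAlive a u ∧ a (j :: u) = true

/-- The stick with the given address comes into existence (its parent is alive, hence breaks) and
is dead. -/
def IsDead {k : ℕ} (a : List (Fin k) → Bool) : List (Fin k) → Prop
  | [] => False
  | j :: u => IsAlive a u ∧ a (j :: u) = false

/-- Potential sticks in the process with `R` initial sticks: the number of the initial stick
and the address below it. -/
abbrev Stick (k R : ℕ) : Type := Fin R × List (Fin k)

/-- The process ends in finitely many levels: after some level there is no living stick. -/
def Terminates {k R : ℕ} (a : Stick k R → Bool) : Prop :=
  ∃ N : ℕ, ∀ p : Stick k R, p.2.length = N → ¬ IsAlive (fun u => a (p.1, u)) p.2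

/-- The index type of the collection of ending sticks. -/
abbrev EndingStick {k R : ℕ} (a : Stick k R → Bool) : Type :=
  {p : Stick k R // IsDead (fun u => a (p.1, u)) p.2}

/-- The lengths of the ending sticks. -/
def endingLength {k R : ℕ} (L : ℝ) (c : Stick k R → (Fin (k - 1) → ℝ)) (a : Stick k R → Bool)
    (p : EndingStick a) : ℝ :=
  stickLength L (fun u => c (p.1.1, u)) p.1.2

/-- The randomness of the process with `R` initial sticks, breaking distribution `D` and survival
probability `r`: all cut points are i.i.d. with law `D`, all statuses are i.i.d., equal to `true`
with probability `r`, and the cut points are independent of the statuses. -/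
structure IsFragmentation {k R : ℕ} {Ω : Type*} [MeasurableSpace Ω] (μ : Measure Ω)
    (D : Measure (Fin (k - 1) → ℝ)) (r : ℝ)
    (cut : Stick k R → Ω → (Fin (k - 1) → ℝ)) (status : Stick k R → Ω → Bool) : Prop where
  measurable_cut : ∀ p, Measurable (cut p)
  measurable_status : ∀ p, Measurable (status p)
  law_cut : ∀ p, μ.map (cut p) = D
  law_status : ∀ p, μ {ω | status p ω = true} = ENNReal.ofReal r
  indep_cut : iIndepFun cut μ
  indep_status : iIndepFun status μ
  indep : IndepFun (fun ω p => cut p ω) (fun ω p => status p ω) μ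

end

end StickFragmentation

open StickFragmentation

/-! By Weyl's criterion it is enough that, for every integer `n ≠ 0`, the average of `χ(x) = exp(2πi
n log_B x)` over the lengths of the ending sticks almost surely tends to `0`. As `χ` is
multiplicative, its value at a length is `χ(L)` times the product of the values of `χ` at the gaps
along the path to the stick. A gap has no atoms, so its mean `φ_j = 𝔼 χ(gap j)` satisfies `‖φ_j‖ ≤ ρ
< 1`.

Fix the tree `T` of living sticks; the ending sticks are its `N` leaves. Replacing the last `d`
factors of every leaf product by their means, one level at a time (`sum_leafWeight_mul_stickProd`),
leaves three errors (`norm_sum_leaves_le`): leaves at level below `d`, at most `R ∑_{i<d} k^i` of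
them; for each `i < d` a sum of centred innovations; and a remainder of size at most `ρ^d N`.

The cuts are independent of the statuses, so for fixed `T` each innovation sum is a sum of `|T| ≤ N`
bounded martingale differences. By a Chernoff bound it exceeds `εN` with probability exponentially
small in `N ≥ R`; summing over the possible trees gives a bound depending on `R` only
(`measure_innovation_ge_le`).

The first error is negligible because `R / N → 0`. Offspring numbers have mean `1`, so at any fixed
level at least about `R/2` sticks live, up to exponentially small probability
(`exists_measure_aliveCount_le`), and summing over `M` levels makes `N` at least about `MR/2`. The
same generating function shows extinction (`ae_terminates`).

All bounds are summable in `R`, so Borel–Cantelli applies whatever the joint law over different `R`.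
Means and variances follow by dominated convergence, proportions lying in `[0, 1]`. -/

namespace StickFragmentation

/-! ### Resampling one coordinate of a product measure -/

section Update

variable {ι E : Type*} [DecidableEq ι] [MeasurableSpace E]

lemma measurable_update_prod (p : ι) :
    Measurable (fun z : (ι → E) × E => Function.update z.1 p z.2) := by
  refine measurable_pi_lambda _ fun q => ?_
  by_cases h : q = p
  · subst h
    simpa using measurable_snd
  · simpa [h] using! (measurable_pi_apply q).comp measurable_fst

lemma map_update_infinitePi (D : Measure E) [IsProbabilityMeasure D] (p : ι) :
    ((Measure.infinitePi fun _ : ι => D).prod D).map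
      (fun z => Function.update z.1 p z.2) = Measure.infinitePi fun _ : ι => D := by
  classical
  refine Measure.eq_infinitePi (μ := fun _ : ι => D) fun s t ht => ?_
  rw [Measure.map_apply (measurable_update_prod p)
    (MeasurableSet.pi s.countable_toSet fun i _ => ht i)]
  have hset : (fun z : (ι → E) × E => Function.update z.1 p z.2) ⁻¹' (Set.pi s t)
      = (Set.pi (s.erase p : Finset ι) t) ×ˢ (if p ∈ s then t p else Set.univ) := by
    ext z
    simp only [Set.mem_preimage, Set.mem_pi, Finset.mem_coe, Set.mem_prod, Finset.mem_erase]
    constructor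
    · intro h
      refine ⟨fun i hi => by simpa [hi.1] using h i hi.2, ?_⟩
      split_ifs with hp
      · simpa using h p hp
      · trivial
    · rintro ⟨h1, h2⟩ i hi
      by_cases hip : i = p
      · subst hip
        simpa [hi] using h2
      · simpa [hip] using h1 i ⟨hip, hi⟩
  rw [hset, Measure.prod_prod, Measure.infinitePi_pi (μ := fun _ : ι => D) fun i _ => ht i]
  split_ifs with hp
  · rw [mul_comm, Finset.mul_prod_erase s (fun i => D (t i)) hp]
  · rw [Finset.erase_eq_of_notMem hp]; simp

/-- This takes the place of conditioning on all coordinates except `p`: the inner integral is the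
conditional expectation, so no filtration is needed. -/
lemma lintegral_infinitePi_update (D : Measure E) [IsProbabilityMeasure D] (p : ι)
    {F : (ι → E) → ℝ≥0∞} (hF : Measurable F) :
    ∫⁻ x, F x ∂(Measure.infinitePi fun _ : ι => D) =
      ∫⁻ x, ∫⁻ y, F (Function.update x p y) ∂D ∂(Measure.infinitePi fun _ : ι => D) := by
  conv_lhs => rw [← map_update_infinitePi D p]
  rw [lintegral_map hF (measurable_update_prod p),
    lintegral_prod (fun z : (ι → E) × E => F (Function.update z.1 p z.2))
      (hF.comp (measurable_update_prod p)).aemeasurable]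

end Update

/-! ### An exponential moment bound for martingale sums -/

/-- On `[-1, 1]` one has `exp y ≤ 1 + y + y ^ 2`. The linear term integrates to zero, and `1 + c ^ 2
≤ exp (c ^ 2)`. -/
lemma lintegral_exp_le_of_integral_eq_zero {E : Type*} [MeasurableSpace E] (D : Measure E)
    [IsProbabilityMeasure D] {f : E → ℝ} (hf : Measurable f) {c : ℝ} (hc : c ≤ 1)
    (hb : ∀ y, |f y| ≤ c) (h0 : ∫ y, f y ∂D = 0) :
    ∫⁻ y, ENNReal.ofReal (Real.exp (f y)) ∂D ≤ ENNReal.ofReal (Real.exp (c ^ 2)) := by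
  have hint : Integrable f D := Integrable.of_bound hf.aestronglyMeasurable c (ae_of_all _ hb)
  have hle : ∀ y, Real.exp (f y) ≤ 1 + c ^ 2 + f y := fun y => by
    have h1 := Real.abs_exp_sub_one_sub_id_le ((hb y).trans hc)
    have h2 := (abs_le.1 h1).2
    have h3 : f y ^ 2 ≤ c ^ 2 := sq_le_sq' (by linarith [(abs_le.1 (hb y)).1]) (abs_le.1 (hb y)).2
    linarith
  have hint2 : Integrable (fun y => 1 + c ^ 2 + f y) D := (integrable_const _).add hint
  calc ∫⁻ y, ENNReal.ofReal (Real.exp (f y)) ∂D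
      ≤ ∫⁻ y, ENNReal.ofReal (1 + c ^ 2 + f y) ∂D :=
        lintegral_mono fun y => ENNReal.ofReal_le_ofReal (hle y)
    _ = ENNReal.ofReal (∫ y, (1 + c ^ 2 + f y) ∂D) :=
        (ofReal_integral_eq_lintegral_ofReal hint2
          (ae_of_all _ fun y => (Real.exp_pos _).le.trans (hle y))).symm
    _ ≤ ENNReal.ofReal (Real.exp (c ^ 2)) := by
        refine ENNReal.ofReal_le_ofReal ?_
        rw [integral_add (integrable_const _) hint, h0]
        simpa [add_comm] using Real.add_one_le_exp (c ^ 2)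

/-- The function `lev` plays the role of time. Resampling a coordinate `p` of maximal level in the
index set changes no term but `Δ p`, whose exponential moment then splits off. -/
lemma lintegral_exp_sum_le {ι E : Type*} [DecidableEq ι] [MeasurableSpace E]
    (D : Measure E) [IsProbabilityMeasure D] (lev : ι → ℕ) (Δ : ι → (ι → E) → ℝ)
    (hmeas : ∀ p, Measurable (Δ p)) {K t : ℝ} (hb : ∀ p x, |Δ p x| ≤ K)
    (hupd : ∀ p q x y, lev q ≤ lev p → q ≠ p → Δ q (Function.update x p y) = Δ q x)
    (hmean : ∀ p x, ∫ y, Δ p (Function.update x p y) ∂D = 0)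
    (ht : 0 ≤ t) (htK : t * K ≤ 1) (S : Finset ι) :
    ∫⁻ x, ENNReal.ofReal (Real.exp (t * ∑ p ∈ S, Δ p x)) ∂(Measure.infinitePi fun _ : ι => D)
      ≤ ENNReal.ofReal (Real.exp ((t * K) ^ 2 * S.card)) := by
  induction S using Finset.induction_on_max_value lev with
  | empty => simp
  | insert p S hp hmax ih =>
    have hm : ∀ S : Finset ι, Measurable fun x =>
        ENNReal.ofReal (Real.exp (t * ∑ q ∈ S, Δ q x)) := fun S => by
      have : Measurable fun x => ∑ q ∈ S, Δ q x := Finset.measurable_sum _ fun q _ => hmeas q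
      fun_prop
    rw [lintegral_infinitePi_update D p (hm _)]
    have hin : ∀ x, ∫⁻ y, ENNReal.ofReal
          (Real.exp (t * ∑ q ∈ insert p S, Δ q (Function.update x p y))) ∂D
        ≤ ENNReal.ofReal (Real.exp (t * ∑ q ∈ S, Δ q x)) *
          ENNReal.ofReal (Real.exp ((t * K) ^ 2)) := fun x => by
      have hsplit : ∀ y, ENNReal.ofReal
          (Real.exp (t * ∑ q ∈ insert p S, Δ q (Function.update x p y))) =
          ENNReal.ofReal (Real.exp (t * ∑ q ∈ S, Δ q x)) *
            ENNReal.ofReal (Real.exp (t * Δ p (Function.update x p y))) := fun y => by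
        rw [← ENNReal.ofReal_mul (Real.exp_pos _).le, ← Real.exp_add, Finset.sum_insert hp,
          Finset.sum_congr rfl fun q hq =>
            hupd p q x y (hmax q hq) (fun h => hp (h ▸ hq))]
        ring_nf
      have hmu : Measurable fun y => Δ p (Function.update x p y) :=
        (hmeas p).comp (measurable_update x)
      simp_rw [hsplit]
      rw [lintegral_const_mul _ (by fun_prop)]
      gcongr
      refine lintegral_exp_le_of_integral_eq_zero D (by fun_prop) htK (fun y => ?_) ?_
      · rw [abs_mul, abs_of_nonneg ht]
        exact mul_le_mul_of_nonneg_left (hb _ _) ht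
      · rw [integral_const_mul, hmean, mul_zero]
    calc _ ≤ ∫⁻ x, ENNReal.ofReal (Real.exp (t * ∑ q ∈ S, Δ q x)) *
          ENNReal.ofReal (Real.exp ((t * K) ^ 2)) ∂(Measure.infinitePi fun _ : ι => D) :=
          lintegral_mono hin
      _ = (∫⁻ x, ENNReal.ofReal (Real.exp (t * ∑ q ∈ S, Δ q x))
            ∂(Measure.infinitePi fun _ : ι => D)) * ENNReal.ofReal (Real.exp ((t * K) ^ 2)) :=
          lintegral_mul_const _ (hm S)
      _ ≤ _ := by
          refine (mul_le_mul_left ih _).trans ?_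
          rw [← ENNReal.ofReal_mul (Real.exp_pos _).le, ← Real.exp_add, Finset.card_insert_of_notMem hp]
          refine ENNReal.ofReal_le_ofReal (Real.exp_le_exp.2 (le_of_eq ?_))
          push_cast; ring

/-- Chernoff bound for sums of at most `N` bounded martingale differences. -/
lemma measure_sum_ge_le {ι E : Type*} [DecidableEq ι] [MeasurableSpace E]
    (D : Measure E) [IsProbabilityMeasure D] (lev : ι → ℕ) (Δ : ι → (ι → E) → ℝ)
    (hmeas : ∀ p, Measurable (Δ p)) {K ε : ℝ} (hb : ∀ p x, |Δ p x| ≤ K)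
    (hupd : ∀ p q x y, lev q ≤ lev p → q ≠ p → Δ q (Function.update x p y) = Δ q x)
    (hmean : ∀ p x, ∫ y, Δ p (Function.update x p y) ∂D = 0)
    (hK : 0 < K) (hε : 0 < ε) (hεK : ε ≤ K) (S : Finset ι) {N : ℝ} (hN : (S.card : ℝ) ≤ N) :
    (Measure.infinitePi fun _ : ι => D) {x | ε * N ≤ ∑ p ∈ S, Δ p x} ≤
      ENNReal.ofReal (Real.exp (-(ε ^ 2 / (4 * K ^ 2)) * N)) := by
  -- This minimizes the exponent `(t * K) ^ 2 * N - t * ε * N`; the minimum is `-(ε ^ 2 / (4 * K ^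
  -- 2)) * N`.
  set t := ε / (2 * K ^ 2) with ht
  have ht0 : 0 < t := by positivity
  have htK : t * K ≤ 1 := by
    rw [ht]; field_simp; linarith
  have h1 := lintegral_exp_sum_le D lev Δ hmeas hb hupd hmean ht0.le htK S
  have hm : Measurable fun x => ENNReal.ofReal (Real.exp (t * ∑ q ∈ S, Δ q x)) := by
    have : Measurable fun x => ∑ q ∈ S, Δ q x := Finset.measurable_sum _ fun q _ => hmeas q
    fun_prop
  have hsub : {x | ε * N ≤ ∑ p ∈ S, Δ p x} ⊆
      {x | ENNReal.ofReal (Real.exp (t * (ε * N))) ≤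
        ENNReal.ofReal (Real.exp (t * ∑ q ∈ S, Δ q x))} := fun x hx =>
    ENNReal.ofReal_le_ofReal (Real.exp_le_exp.2 (mul_le_mul_of_nonneg_left hx ht0.le))
  refine (measure_mono hsub).trans ((meas_ge_le_lintegral_div hm.aemeasurable
    (by simp [Real.exp_pos]) ENNReal.ofReal_ne_top).trans ?_)
  rw [ENNReal.div_le_iff_le_mul (by simp [Real.exp_pos]) (by simp),
    ← ENNReal.ofReal_mul (Real.exp_pos _).le, ← Real.exp_add]
  refine h1.trans (ENNReal.ofReal_le_ofReal (Real.exp_le_exp.2 ?_))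
  have : (t * K) ^ 2 * S.card ≤ (t * K) ^ 2 * N := by gcongr
  refine this.trans (le_of_eq ?_)
  rw [ht]; field_simp; ring

/-! ### Addresses of sticks -/

section Sticks

variable {k R : ℕ}

/-- The address of the `j`-th piece of the stick `u`. -/
def child (u : Stick k R) (j : Fin k) : Stick k R := (u.1, j :: u.2)

lemma child_inj {u v : Stick k R} {i j : Fin k} : child u i = child v j ↔ u = v ∧ i = j := by
  simp only [child, Prod.ext_iff, List.cons.injEq]
  tauto

/-- The embedding of the initial sticks. -/
def rootEmb : Fin R ↪ Stick k R := ⟨fun i => (i, []), fun i j h => by simpa using h⟩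

/-- The embedding sending a stick and a piece number to the piece. -/
def childEmb : Stick k R × Fin k ↪ Stick k R :=
  ⟨fun z => child z.1 z.2, fun _ _ h => Prod.ext_iff.2 (child_inj.1 h)⟩

lemma rootEmb_apply (i : Fin R) : (rootEmb i : Stick k R) = (i, []) := rfl

lemma childEmb_apply (z : Stick k R × Fin k) : childEmb z = child z.1 z.2 := rfl

/-- The initial sticks. -/
def roots (k R : ℕ) : Finset (Stick k R) := Finset.univ.map rootEmb

/-- All pieces of the sticks in `T`. -/
def children (T : Finset (Stick k R)) : Finset (Stick k R) :=
  (T ×ˢ Finset.univ).map childEmb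

lemma mem_roots {p : Stick k R} : p ∈ roots k R ↔ p.2 = [] := by
  simp only [roots, Finset.mem_map, Finset.mem_univ, true_and, rootEmb_apply]
  exact ⟨by rintro ⟨i, rfl⟩; rfl, fun h => ⟨p.1, Prod.ext rfl h.symm⟩⟩

lemma mem_children {T : Finset (Stick k R)} {p : Stick k R} :
    p ∈ children T ↔ ∃ u ∈ T, ∃ j, child u j = p := by
  simp only [children, Finset.mem_map, Finset.mem_product, Finset.mem_univ, and_true,
    childEmb_apply, Prod.exists]
  aesop

lemma child_mem_children {T : Finset (Stick k R)} {u : Stick k R} {j : Fin k} :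
    child u j ∈ children T ↔ u ∈ T := by
  rw [mem_children]
  constructor
  · rintro ⟨v, hv, i, h⟩
    exact (child_inj.1 h).1 ▸ hv
  · exact fun h => ⟨u, h, j, rfl⟩

@[simp] lemma card_roots : (roots k R).card = R := by simp [roots]

@[simp] lemma card_children (T : Finset (Stick k R)) : (children T).card = T.card * k := by
  simp [children]

lemma sum_roots {M : Type*} [AddCommMonoid M] (f : Stick k R → M) :
    ∑ p ∈ roots k R, f p = ∑ i, f (i, []) := by simp [roots, rootEmb_apply]

lemma sum_children {M : Type*} [AddCommMonoid M] (T : Finset (Stick k R)) (f : Stick k R → M) :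
    ∑ p ∈ children T, f p = ∑ u ∈ T, ∑ j, f (child u j) := by
  simp [children, Finset.sum_product, childEmb_apply]

lemma prod_children {M : Type*} [CommMonoid M] (T : Finset (Stick k R)) (f : Stick k R → M) :
    ∏ p ∈ children T, f p = ∏ u ∈ T, ∏ j, f (child u j) := by
  simp [children, Finset.prod_product, childEmb_apply]

/-- The sticks of level `n`. -/
def levelSet (k R : ℕ) : ℕ → Finset (Stick k R)
  | 0 => roots k R
  | n + 1 => children (levelSet k R n)

lemma mem_levelSet {n : ℕ} {p : Stick k R} : p ∈ levelSet k R n ↔ p.2.length = n := by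
  induction n generalizing p with
  | zero => rw [levelSet, mem_roots, List.length_eq_zero_iff]
  | succ n ih =>
    obtain ⟨i, _ | ⟨j, u⟩⟩ := p
    · simp [levelSet, mem_children, child]
    · rw [levelSet, show ((i, j :: u) : Stick k R) = child (i, u) j from rfl, child_mem_children, ih]
      simp [child]

/-- The stick exists and is alive. -/
def Alive (a : Stick k R → Bool) (p : Stick k R) : Prop := IsAlive (fun u => a (p.1, u)) p.2

lemma alive_root (a : Stick k R → Bool) (i : Fin R) : Alive a (i, []) := trivial

lemma alive_child (a : Stick k R → Bool) (u : Stick k R) (j : Fin k) :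
    Alive a (child u j) ↔ Alive a u ∧ a (child u j) = true := Iff.rfl

lemma isDead_child (a : Stick k R → Bool) (u : Stick k R) (j : Fin k) :
    IsDead (fun v => a ((child u j).1, v)) (child u j).2 ↔ Alive a u ∧ a (child u j) = false :=
  Iff.rfl

@[elab_as_elim]
lemma stick_induction {motive : Stick k R → Prop} (root : ∀ i, motive (i, []))
    (step : ∀ u j, motive u → motive (child u j)) (p : Stick k R) : motive p := by
  obtain ⟨i, u⟩ := p
  induction u with
  | nil => exact root i
  | cons j u ih => exact step (i, u) j ih

/-- A status affects only the stick itself and its descendants, which have strictly larger level. -/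
lemma alive_update {a : Stick k R → Bool} {p q : Stick k R} {y : Bool}
    (hl : q.2.length ≤ p.2.length) (hne : q ≠ p) :
    Alive (Function.update a p y) q ↔ Alive a q := by
  induction q using stick_induction with
  | root i => exact Iff.rfl
  | step u j ih =>
    have hlt : u.2.length < p.2.length := Nat.lt_of_succ_le hl
    rw [alive_child, alive_child, ih hlt.le (fun h => by simp [h] at hlt),
      Function.update_of_ne hne]

lemma measurableSet_alive (p : Stick k R) : MeasurableSet {a : Stick k R → Bool | Alive a p} := by
  induction p using stick_induction with
  | root i => exact MeasurableSet.univ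
  | step u j ih =>
    simp only [alive_child]
    exact ih.inter (measurableSet_eq_fun (measurable_pi_apply (child u j)) measurable_const)

lemma terminates_iff {a : Stick k R → Bool} :
    Terminates a ↔ ∃ n, ∀ p ∈ levelSet k R n, ¬ Alive a p := by
  simp only [Terminates, mem_levelSet, Alive]

lemma measurableSet_terminates : MeasurableSet {a : Stick k R → Bool | Terminates a} := by
  simp only [terminates_iff, Set.ofPred_exists, Set.ofPred_forall]
  exact MeasurableSet.iUnion fun n => MeasurableSet.iInter fun p => MeasurableSet.iInter fun _ =>
    (measurableSet_alive p).compl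

end Sticks

/-! ### The generating function of the number of living sticks -/

/-- The generating function of the number of living pieces of a stick. -/
noncomputable def offspringGF (k : ℕ) (s : ℝ) : ℝ := (1 - 1 / k + 1 / k * s) ^ k

section GF

variable {k : ℕ}

lemma offspringGF_one : offspringGF k 1 = 1 := by simp [offspringGF]

lemma offspringGF_nonneg (hk : 2 ≤ k) {s : ℝ} (hs : 0 ≤ s) : 0 ≤ offspringGF k s := by
  have : (1 : ℝ) / k ≤ 1 := by
    rw [div_le_one (by positivity)]; exact_mod_cast (by omega : 1 ≤ k)
  have : 0 ≤ 1 / (k : ℝ) * s := by positivity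
  exact pow_nonneg (by linarith) _

lemma offspringGF_iterate_nonneg (hk : 2 ≤ k) {s : ℝ} (hs : 0 ≤ s) (n : ℕ) :
    0 ≤ (offspringGF k)^[n] s := by
  induction n with
  | zero => exact hs
  | succ n ih => rw [Function.iterate_succ_apply']; exact offspringGF_nonneg hk ih

lemma hasDerivAt_offspringGF_one (hk : 2 ≤ k) : HasDerivAt (offspringGF k) 1 1 := by
  have hk0 : (k : ℝ) ≠ 0 := by positivity
  have h : HasDerivAt (fun s : ℝ => (1 - 1 / (k : ℝ) + 1 / k * s) ^ k) _ 1 :=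
    (((hasDerivAt_id' (1 : ℝ)).const_mul (1 / (k : ℝ))).const_add (1 - 1 / (k : ℝ))).fun_pow k
  exact h.congr_deriv (by simp [hk0])

/-- Strict Bernoulli inequality: `(1 - (1 - s) / k) ^ k > 1 - (1 - s)`. -/
lemma lt_offspringGF (hk : 2 ≤ k) {s : ℝ} (h0 : 0 ≤ s) (h1 : s < 1) : s < offspringGF k s := by
  have hk0 : (0 : ℝ) < k := by positivity
  have hk2 : (2 : ℝ) ≤ k := by exact_mod_cast hk
  have h := one_add_mul_self_lt_rpow_one_add (s := -((1 - s) / k)) (p := k)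
    (by rw [neg_le_neg_iff, div_le_one hk0]; linarith)
    (neg_ne_zero.2 (div_pos (by linarith) hk0).ne')
    (by linarith)
  rw [Real.rpow_natCast] at h
  have e1 : 1 + (k : ℝ) * -((1 - s) / k) = s := by field_simp; ring
  have e2 : (1 : ℝ) + -((1 - s) / k) = 1 - 1 / k + 1 / k * s := by field_simp; ring
  rw [e1, e2] at h
  exact h

lemma offspringGF_le_one (hk : 2 ≤ k) {s : ℝ} (h0 : 0 ≤ s) (h1 : s ≤ 1) : offspringGF k s ≤ 1 := by
  have hk0 : (0 : ℝ) < k := by positivity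
  have h2 : 1 / (k : ℝ) ≤ 1 := by
    rw [div_le_one hk0]; exact_mod_cast (by omega : 1 ≤ k)
  have h3 : 1 / (k : ℝ) * s ≤ 1 / k := mul_le_of_le_one_right (by positivity) h1
  have h4 : 0 ≤ 1 / (k : ℝ) * s := by positivity
  exact pow_le_one₀ (by linarith) (by linarith)

/-- The orbit of `0` increases and is bounded by `1`, so it converges to a fixed point in `[0, 1]`,
and `1` is the only one. -/
lemma tendsto_offspringGF_iterate_zero (hk : 2 ≤ k) :
    Tendsto (fun n => (offspringGF k)^[n] 0) atTop (𝓝 1) := by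
  have hle : ∀ n, (offspringGF k)^[n] 0 ≤ 1 := fun n => by
    induction n with
    | zero => simp
    | succ n ih =>
      rw [Function.iterate_succ_apply']
      exact offspringGF_le_one hk (offspringGF_iterate_nonneg hk le_rfl n) ih
  have hmono : Monotone fun n => (offspringGF k)^[n] 0 := monotone_nat_of_le_succ fun n => by
    rw [Function.iterate_succ_apply']
    rcases (hle n).lt_or_eq with h | h
    · exact (lt_offspringGF hk (offspringGF_iterate_nonneg hk le_rfl n) h).le
    · rw [h, offspringGF_one]
  have hlim := tendsto_atTop_ciSup hmono ⟨1, by rintro _ ⟨n, rfl⟩; exact hle n⟩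
  set l := ⨆ n, (offspringGF k)^[n] 0
  have hcont : Continuous (offspringGF k) := by unfold offspringGF; fun_prop
  have hfix : offspringGF k l = l :=
    isFixedPt_of_tendsto_iterate hlim hcont.continuousAt
  have hl1 : l ≤ 1 := le_of_tendsto' hlim hle
  have hl0 : 0 ≤ l := ge_of_tendsto' hlim fun n => offspringGF_iterate_nonneg hk le_rfl n
  rcases hl1.lt_or_eq with h | h
  · exact absurd hfix (lt_offspringGF hk hl0 h).ne'
  · rwa [h] at hlim

/-- Criticality gives the `n`-th iterate derivative `1` at its fixed point `1`, so `t ↦ f^[n] (t ^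
2)` has slope `2` there, steeper than `t ↦ t`, and lies below it just to the left of `1`. The square
matches the threshold `R / 2` in `exists_measure_aliveCount_le`. -/
lemma exists_offspringGF_iterate_sq_lt (hk : 2 ≤ k) (n : ℕ) :
    ∃ t : ℝ, 0 < t ∧ t < 1 ∧ (offspringGF k)^[n] (t ^ 2) < t := by
  have h1 : HasDerivAt ((offspringGF k)^[n]) 1 1 := by
    have := HasDerivAt.iterate (x := (1 : ℝ)) (hasDerivAt_offspringGF_one hk) offspringGF_one n
    simpa using this
  have h1' : HasDerivAt ((offspringGF k)^[n]) 1 ((1 : ℝ) ^ 2) := by simpa using h1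
  have h2 : HasDerivAt (fun t : ℝ => (offspringGF k)^[n] (t ^ 2) - t) 1 1 := by
    have h3 : HasDerivAt (fun t : ℝ => (offspringGF k)^[n] (t ^ 2)) (1 * (2 * 1)) 1 :=
      HasDerivAt.comp (h := fun t : ℝ => t ^ 2) (1 : ℝ) h1'
        ((hasDerivAt_pow 2 (1 : ℝ)).congr_deriv (by norm_num))
    exact (h3.fun_sub (hasDerivAt_id' (1 : ℝ))).congr_deriv (by norm_num)
  have hfix : (offspringGF k)^[n] 1 = 1 := Function.IsFixedPt.iterate (f := offspringGF k) offspringGF_one n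
  have h3 := (hasDerivAt_iff_tendsto_slope.1 h2).eventually (lt_mem_nhds (zero_lt_one' ℝ))
  have h4 : ∀ᶠ t in 𝓝[<] (1 : ℝ), 0 < slope (fun t : ℝ => (offspringGF k)^[n] (t ^ 2) - t) 1 t :=
    h3.filter_mono (nhdsWithin_mono _ fun x hx => ne_of_lt hx)
  have h5 : ∀ᶠ t in 𝓝[<] (1 : ℝ), t ∈ Set.Ioo (0 : ℝ) 1 := Ioo_mem_nhdsLT one_pos
  obtain ⟨t, ht, ht0, ht1⟩ := (h4.and h5).exists
  refine ⟨t, ht0, ht1, ?_⟩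
  rw [slope_def_field, one_pow, hfix, sub_self, sub_zero] at ht
  rcases div_pos_iff.1 ht with h | h <;> linarith [h.1, h.2]

end GF

section StatusLaw

variable {k R : ℕ} (ν : Measure Bool)

lemma lintegral_bool (f : Bool → ℝ≥0∞) :
    ∫⁻ y, f y ∂ν = f true * ν {true} + f false * ν {false} := by
  rw [lintegral_fintype, Fintype.sum_bool]

variable [IsProbabilityMeasure ν]

open Classical in
lemma measurable_alive_ite (s : ℝ≥0∞) (p : Stick k R) :
    Measurable fun a : Stick k R → Bool => if Alive a p then s else 1 :=
  Measurable.ite (measurableSet_alive p) measurable_const measurable_const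

open Classical in
-- The statuses of level `n + 1` are integrated out one at a time. The factor `H` collects the
-- factors already treated, which involve only levels up to `n`.
lemma lintegral_prod_alive_children (s : ℝ≥0∞) (n : ℕ) (S : Finset (Stick k R × Fin k))
    (hS : ∀ z ∈ S, z.1.2.length = n) (H : (Stick k R → Bool) → ℝ≥0∞) (hH : Measurable H)
    (hupd : ∀ a p y, p.2.length = n + 1 → H (Function.update a p y) = H a) :
    ∫⁻ a, (∏ z ∈ S, if Alive a (child z.1 z.2) then s else 1) * H a
        ∂(Measure.infinitePi fun _ : Stick k R => ν) =
      ∫⁻ a, (∏ z ∈ S, if Alive a z.1 then s * ν {true} + ν {false} else 1) * H a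
        ∂(Measure.infinitePi fun _ : Stick k R => ν) := by
  induction S using Finset.induction_on generalizing H with
  | empty => simp
  | insert z S hz ih =>
    have hzn := hS z (Finset.mem_insert_self z S)
    have hS' : ∀ w ∈ S, w.1.2.length = n := fun w hw => hS w (Finset.mem_insert_of_mem hw)
    have hmS : Measurable fun a : Stick k R → Bool =>
        ∏ w ∈ S, if Alive a (child w.1 w.2) then s else 1 :=
      Finset.measurable_prod _ fun w _ => measurable_alive_ite s _
    have hlen : (child z.1 z.2).2.length = n + 1 := by simp [child, hzn]
    have key : ∫⁻ a, (∏ w ∈ insert z S, if Alive a (child w.1 w.2) then s else 1) * H a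
          ∂(Measure.infinitePi fun _ : Stick k R => ν) =
        ∫⁻ a, (∏ w ∈ S, if Alive a (child w.1 w.2) then s else 1) *
          ((if Alive a z.1 then s * ν {true} + ν {false} else 1) * H a)
          ∂(Measure.infinitePi fun _ : Stick k R => ν) := by
      simp_rw [Finset.prod_insert hz]
      have hm : Measurable fun a : Stick k R → Bool => ((if Alive a (child z.1 z.2) then s else 1) *
          ∏ w ∈ S, if Alive a (child w.1 w.2) then s else 1) * H a :=
        ((measurable_alive_ite s _).mul hmS).mul hH
      rw [lintegral_infinitePi_update ν (child z.1 z.2) hm]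
      refine lintegral_congr fun a => ?_
      have e1 : ∀ y, ∏ w ∈ S, (if Alive (Function.update a (child z.1 z.2) y) (child w.1 w.2)
          then s else 1) = ∏ w ∈ S, if Alive a (child w.1 w.2) then s else 1 := fun y => by
        refine Finset.prod_congr rfl fun w hw => ?_
        have : child w.1 w.2 ≠ child z.1 z.2 := fun h => by
          have := child_inj.1 h
          exact hz (Prod.ext_iff.2 this ▸ hw)
        rw [alive_update (by simp [child, hzn, hS' w hw]) this]
      have e2 : ∀ y, Alive (Function.update a (child z.1 z.2) y) (child z.1 z.2) ↔
          Alive a z.1 ∧ y = true := fun y => by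
        rw [alive_child, alive_update (by simp [child]) (fun h => by
          have := congrArg (fun p => p.2.length) h
          simp [child] at this), Function.update_self]
      simp_rw [e1, e2, hupd a _ _ hlen, lintegral_bool]
      have h1 : ν {true} + ν {false} = 1 := by
        have := lintegral_bool ν (fun _ => 1)
        rw [lintegral_const, measure_univ] at this
        simpa using this.symm
      by_cases ha : Alive a z.1
      · simp only [ha, true_and, if_true, Bool.false_eq_true, if_false]
        ring
      · simp only [ha, false_and, if_false]
        rw [← mul_add, h1]
        ring
    have hm : Measurable fun a : Stick k R → Bool =>
        (if Alive a z.1 then s * ν {true} + ν {false} else 1) * H a :=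
      (measurable_alive_ite _ _).mul hH
    rw [key, ih hS' _ hm fun a p y hp => by
      rw [hupd a p y hp, alive_update (by omega) (fun h => by
        rw [← h] at hp; omega)]]
    refine lintegral_congr fun a => ?_
    rw [Finset.prod_insert hz]
    ring

open Classical in
-- Branching property: integrating out the last level replaces `s` by `offspringGF k s` at each
-- living parent, so the iteration acts on the argument.
lemma lintegral_prod_alive (hk : 2 ≤ k) (hν : ν {true} = ENNReal.ofReal (1 / k)) (n : ℕ)
    {s : ℝ} (hs : 0 ≤ s) :
    ∫⁻ a, ∏ p ∈ levelSet k R n, (if Alive a p then ENNReal.ofReal s else 1)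
        ∂(Measure.infinitePi fun _ : Stick k R => ν) =
      ENNReal.ofReal ((offspringGF k)^[n] s) ^ R := by
  have hk1 : (1 : ℝ) / k ≤ 1 := by
    rw [div_le_one (by positivity)]; exact_mod_cast (by omega : 1 ≤ k)
  have hfalse : ν {false} = ENNReal.ofReal (1 - 1 / k) := by
    rw [ENNReal.ofReal_sub _ (by positivity), ← hν, ENNReal.ofReal_one,
      ← prob_compl_eq_one_sub (MeasurableSet.singleton true)]
    congr 1
    ext b; cases b <;> simp
  induction n generalizing s with
  | zero =>
    simp only [levelSet, roots, Finset.prod_map, rootEmb_apply, alive_root, if_true]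
    simp
  | succ n ih =>
    have h := lintegral_prod_alive_children ν (ENNReal.ofReal s) n (levelSet k R n ×ˢ Finset.univ)
      (fun z hz => mem_levelSet.1 (Finset.mem_product.1 hz).1) (fun _ => 1) measurable_const
      (fun _ _ _ _ => rfl)
    simp only [mul_one, Finset.prod_product] at h
    simp only [levelSet, prod_children]
    rw [h, Function.iterate_succ_apply, ← ih (offspringGF_nonneg hk hs)]
    refine lintegral_congr fun a => Finset.prod_congr rfl fun p _ => ?_
    by_cases hp : Alive a p
    · simp only [hp, if_true, Finset.prod_const, Finset.card_univ, Fintype.card_fin]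
      rw [hν, hfalse, ← ENNReal.ofReal_mul hs,
        ← ENNReal.ofReal_add (by positivity) (by linarith),
        ← ENNReal.ofReal_pow (add_nonneg (by positivity) (by linarith)), offspringGF]
      congr 2; ring
    · simp only [hp, if_false, Finset.prod_const_one]

/-- A critical process dies out. -/
lemma ae_terminates (hk : 2 ≤ k) (hν : ν {true} = ENNReal.ofReal (1 / k)) :
    ∀ᵐ a ∂(Measure.infinitePi fun _ : Stick k R => ν), Terminates a := by
  classical
  set P := Measure.infinitePi fun _ : Stick k R => ν
  -- At `s = 0` the product in `lintegral_prod_alive` is the indicator of extinction by level `n`.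
  have hsub : ∀ n, ENNReal.ofReal ((offspringGF k)^[n] 0) ^ R ≤ P {a | Terminates a} := fun n => by
    rw [← lintegral_prod_alive ν hk hν n le_rfl, ← lintegral_indicator_one measurableSet_terminates]
    refine lintegral_mono fun a => ?_
    by_cases ha : ∃ p ∈ levelSet k R n, Alive a p
    · obtain ⟨p, hp, hap⟩ := ha
      rw [Finset.prod_eq_zero hp (by simp [hap])]
      exact bot_le
    · push Not at ha
      have : a ∈ {a : Stick k R → Bool | Terminates a} := terminates_iff.2 ⟨n, ha⟩
      rw [Set.indicator_of_mem this, Finset.prod_congr rfl fun p hp => if_neg (ha p hp)]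
      simp
  have hlim : Tendsto (fun n => ENNReal.ofReal ((offspringGF k)^[n] 0) ^ R) atTop (𝓝 1) := by
    have := ENNReal.Tendsto.pow (n := R)
      (ENNReal.tendsto_ofReal (tendsto_offspringGF_iterate_zero hk))
    simpa using this
  exact (mem_ae_iff_prob_eq_one measurableSet_terminates).2
    (le_antisymm prob_le_one (le_of_tendsto' hlim hsub))

open Classical in
/-- The number of living sticks of level `n`. -/
noncomputable def aliveCount (a : Stick k R → Bool) (n : ℕ) : ℕ :=
  {p ∈ levelSet k R n | Alive a p}.card

/-- Lower deviations of the number of living sticks are exponentially unlikely. -/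
lemma exists_measure_aliveCount_le (hk : 2 ≤ k) (n : ℕ) :
    ∃ q : ℝ, 0 ≤ q ∧ q < 1 ∧ ∀ (R : ℕ) (ν : Measure Bool) [IsProbabilityMeasure ν],
      ν {true} = ENNReal.ofReal (1 / k) →
      (Measure.infinitePi fun _ : Stick k R => ν) {a | 2 * aliveCount a n ≤ R} ≤
        ENNReal.ofReal (q ^ R) := by
  classical
  obtain ⟨t, ht0, ht1, ht⟩ := exists_offspringGF_iterate_sq_lt hk n
  -- Markov's inequality for `(t ^ 2) ^ Z`, with `Z` the number of living sticks: since `t < 1`, the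
  -- event `2 * Z ≤ R` forces `(t ^ 2) ^ Z ≥ t ^ R`, and the `R`-th root of the resulting bound is
  -- this quotient.
  refine ⟨(offspringGF k)^[n] (t ^ 2) / t,
    div_nonneg (offspringGF_iterate_nonneg hk (sq_nonneg t) n) ht0.le,
    (div_lt_one ht0).2 ht, fun R ν _ hν => ?_⟩
  have hI := lintegral_prod_alive (R := R) ν hk hν n (sq_nonneg t)
  have hm : Measurable fun a : Stick k R → Bool =>
      ∏ p ∈ levelSet k R n, if Alive a p then ENNReal.ofReal (t ^ 2) else 1 :=
    Finset.measurable_prod _ fun p _ => measurable_alive_ite _ p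
  have hsub : {a : Stick k R → Bool | 2 * aliveCount a n ≤ R} ⊆
      {a | ENNReal.ofReal (t ^ R) ≤
        ∏ p ∈ levelSet k R n, if Alive a p then ENNReal.ofReal (t ^ 2) else 1} := fun a ha => by
    simp only [Set.mem_ofPred_eq] at ha ⊢
    rw [← Finset.prod_filter, Finset.prod_const, ← ENNReal.ofReal_pow (sq_nonneg t), ← pow_mul]
    exact ENNReal.ofReal_le_ofReal (pow_le_pow_of_le_one ht0.le ht1.le ha)
  refine (measure_mono hsub).trans ((meas_ge_le_lintegral_div hm.aemeasurable
    (by simp [ht0]) ENNReal.ofReal_ne_top).trans ?_)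
  rw [hI, ← ENNReal.ofReal_pow (offspringGF_iterate_nonneg hk (sq_nonneg t) n),
    ← ENNReal.ofReal_div_of_pos (by positivity), div_pow]

end StatusLaw

/-! ### Gaps between order statistics -/

section Gap

variable {m : ℕ}

/-- The sorting permutation is avoided by counting: the sorted entry with zero-based index `i` is at
most `t` exactly when more than `i` coordinates are. -/
lemma measurable_orderStat (i : ℕ) : Measurable fun x : Fin m → ℝ => orderStat x i := by
  cases i with
  | zero => exact measurable_const
  | succ i =>
    simp only [orderStat]
    split_ifs with h
    · refine measurable_of_Iic fun t => ?_
      have hset : (fun x : Fin m → ℝ => x (Tuple.sort x ⟨i, h⟩)) ⁻¹' Set.Iic t =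
          {x | i < ∑ j, if x j ≤ t then 1 else 0} := by
        ext x
        have h1 := Tuple.lt_card_le_iff_apply_le_of_monotone (a := t) (j := ⟨i, h⟩)
          (Tuple.monotone_sort x)
        rw [Set.mem_preimage, Set.mem_Iic, Set.mem_ofPred_eq,
          ← Equiv.sum_comp (Tuple.sort x) fun j => if x j ≤ t then 1 else 0]
        rw [Finset.card_filter] at h1
        exact h1.symm
      rw [hset]
      refine measurableSet_lt measurable_const (Finset.measurable_sum _ fun j _ => ?_)
      exact Measurable.ite (measurableSet_le (measurable_pi_apply j) measurable_const)
        measurable_const measurable_const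
    · exact measurable_const

lemma measurable_gap (i : ℕ) : Measurable fun x : Fin m → ℝ => gap x i :=
  (measurable_orderStat (i + 1)).sub (measurable_orderStat i)

lemma IsGood.measure_gap_eq {D : Measure (Fin m → ℝ)} (hD : IsGood D) {i : ℕ} (hi : i ≤ m)
    (t : ℝ) : D {x | gap x i = t} = 0 := by
  obtain ⟨C, α, f, -, -, -, -, hf⟩ := hD.density i hi
  have h1 : D {x | gap x i = t} = D.map (fun x => gap x i) {t} := by
    rw [Measure.map_apply (measurable_gap i) (MeasurableSet.singleton t)]
    rfl
  rw [h1, hf]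
  exact withDensity_absolutelyContinuous _ _
    (Measure.absolutelyContinuous_of_le Measure.restrict_le_self (by simp))

lemma IsGood.ae_gap_pos {D : Measure (Fin m → ℝ)} (hD : IsGood D) {i : ℕ} (hi : i ≤ m) :
    ∀ᵐ x ∂D, 0 < gap x i := by
  obtain ⟨C, α, f, -, -, -, -, hf⟩ := hD.density i hi
  have h1 : ∀ᵐ t ∂(D.map fun x => gap x i), t ∈ Set.Icc (0 : ℝ) 1 := by
    rw [hf]
    exact withDensity_absolutelyContinuous _ _ |>.ae_le (ae_restrict_mem measurableSet_Icc)
  have h2 := ae_of_ae_map (measurable_gap i).aemeasurable h1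
  have h3 : ∀ᵐ x ∂D, gap x i ≠ 0 := by
    rw [ae_iff]; simpa using hD.measure_gap_eq hi 0
  filter_upwards [h2, h3] with x hx hx' using lt_of_le_of_ne hx.1 hx'.symm

end Gap

/-! ### Logarithmic characters -/

/-- The character `exp (2 π i n log_B x)`. -/
noncomputable def logChar (B : ℝ) (n : ℤ) (x : ℝ) : ℂ :=
  fourier n ((Real.logb B x : ℝ) : UnitAddCircle)

section LogChar

variable {B : ℝ} {n : ℤ}

lemma measurable_logChar : Measurable (logChar B n) := by
  have h1 : Measurable (Real.logb B) := Real.measurable_log.div_const _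
  have h2 : Continuous fun x : ℝ => (fourier n ((x : ℝ) : UnitAddCircle) : ℂ) :=
    (fourier n).continuous.comp (AddCircle.continuous_mk' 1)
  exact h2.measurable.comp h1

lemma norm_logChar (x : ℝ) : ‖logChar B n x‖ = 1 := Circle.norm_coe _

lemma logChar_mul {x y : ℝ} (hx : 0 < x) (hy : 0 < y) :
    logChar B n (x * y) = logChar B n x * logChar B n y := by
  simp only [logChar, Real.logb_mul hx.ne' hy.ne', AddCircle.coe_add, fourier_apply, smul_add,
    AddCircle.toCircle_add, Circle.coe_mul]

/-- Any two solutions differ by a factor `B ^ (m / n)` with `m` an integer. -/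
lemma countable_logChar_eq (hB : 1 < B) (hn : n ≠ 0) (z : ℂ) :
    {y : ℝ | 0 < y ∧ logChar B n y = z}.Countable := by
  rcases Set.eq_empty_or_nonempty {y : ℝ | 0 < y ∧ logChar B n y = z} with h | ⟨y₀, -, h0⟩
  · simp [h]
  refine (Set.countable_range fun m : ℤ => B ^ ((m : ℝ) / n + Real.logb B y₀)).mono ?_
  rintro y ⟨hy, hyz⟩
  have h1 : (n • ((Real.logb B y : ℝ) : UnitAddCircle)) = n • ((Real.logb B y₀ : ℝ) : UnitAddCircle) := by
    have : logChar B n y = logChar B n y₀ := hyz.trans h0.symm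
    simp only [logChar, fourier_apply] at this
    exact AddCircle.injective_toCircle one_ne_zero (Subtype.ext this)
  rw [← sub_eq_zero, ← smul_sub, ← AddCircle.coe_sub, ← AddCircle.coe_zsmul,
    AddCircle.coe_eq_zero_iff] at h1
  obtain ⟨m, hm⟩ := h1
  refine ⟨m, ?_⟩
  have hn' : (n : ℝ) ≠ 0 := by exact_mod_cast hn
  have h2 : (m : ℝ) / n + Real.logb B y₀ = Real.logb B y := by
    simp only [zsmul_eq_mul, mul_one] at hm
    rw [hm]; field_simp; ring
  simp only [h2]
  exact Real.rpow_logb (by linarith) hB.ne' hy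

/-- Modulus `1` would force the character to be almost surely constant along `f`, so that `f` would
take values in a countable set, which is impossible without atoms. -/
lemma norm_integral_logChar_lt_one {E : Type*} [MeasurableSpace E] (D : Measure E)
    [IsProbabilityMeasure D] (hB : 1 < B) (hn : n ≠ 0) {f : E → ℝ}
    (hpos : ∀ᵐ x ∂D, 0 < f x) (hatom : ∀ t, D {x | f x = t} = 0) :
    ‖∫ x, logChar B n (f x) ∂D‖ < 1 := by
  rcases ae_eq_const_or_norm_integral_lt_of_norm_le_const (μ := D) (C := 1)
    (ae_of_all _ fun x => (norm_logChar (B := B) (n := n) (f x)).le) with h | h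
  · exfalso
    set z := ⨍ x, logChar B n (f x) ∂D
    have h1 : D (⋃ t ∈ {y : ℝ | 0 < y ∧ logChar B n y = z}, {x | f x = t}) = 0 :=
      (measure_biUnion_null_iff (countable_logChar_eq hB hn z)).2 fun t _ => hatom t
    have h2 : ∀ᵐ x ∂D, x ∈ ⋃ t ∈ {y : ℝ | 0 < y ∧ logChar B n y = z}, {x | f x = t} := by
      filter_upwards [hpos, h] with x hx hx'
      simp only [Set.mem_iUnion]
      exact ⟨f x, ⟨hx, hx'⟩, rfl⟩
    obtain ⟨x, hx1, hx2⟩ := (h2.and (measure_eq_zero_iff_ae_notMem.1 h1)).exists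
    exact hx2 hx1
  · simpa using h

end LogChar

/-! ### Characters of stick lengths -/

/-- The product of `χ L` and of the values of `χ` at the proportions on the path to a stick. -/
noncomputable def pathProd {k : ℕ} (χ : ℝ → ℂ) (L : ℝ) (c : List (Fin k) → (Fin (k - 1) → ℝ)) :
    List (Fin k) → ℂ
  | [] => χ L
  | j :: u => pathProd χ L c u * χ (gap (c u) j)

section Path

variable {k R : ℕ} (χ : ℝ → ℂ) (L : ℝ)

/-- `pathProd` for the process with `R` initial sticks. -/
noncomputable def stickProd (c : Stick k R → (Fin (k - 1) → ℝ)) (p : Stick k R) : ℂ :=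
  pathProd χ L (fun u => c (p.1, u)) p.2

/-- The length of a stick in the process with `R` initial sticks. -/
noncomputable def len (c : Stick k R → (Fin (k - 1) → ℝ)) (p : Stick k R) : ℝ :=
  stickLength L (fun u => c (p.1, u)) p.2

lemma stickProd_root (c : Stick k R → (Fin (k - 1) → ℝ)) (i : Fin R) :
    stickProd χ L c (i, []) = χ L := rfl

lemma stickProd_child (c : Stick k R → (Fin (k - 1) → ℝ)) (u : Stick k R) (j : Fin k) :
    stickProd χ L c (child u j) = stickProd χ L c u * χ (gap (c u) j) := rfl

lemma len_child (c : Stick k R → (Fin (k - 1) → ℝ)) (u : Stick k R) (j : Fin k) :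
    len L c (child u j) = len L c u * gap (c u) j := rfl

lemma measurable_len (p : Stick k R) :
    Measurable fun c : Stick k R → (Fin (k - 1) → ℝ) => len L c p := by
  induction p using stick_induction with
  | root i => exact measurable_const
  | step u j ih =>
    simp only [len_child]
    exact ih.mul ((measurable_gap j).comp (measurable_pi_apply u))

variable {L} in
lemma len_pos (hL : 0 < L) {c : Stick k R → (Fin (k - 1) → ℝ)}
    (hc : ∀ u (j : Fin k), 0 < gap (c u) j) (p : Stick k R) : 0 < len L c p := by
  induction p using stick_induction with
  | root i => exact hL
  | step u j ih => rw [len_child]; exact mul_pos ih (hc u j)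

variable {L} in
-- The character is multiplicative only on positive numbers. `stickProd` is a product for every cut
-- configuration, so the martingale estimates need no exceptional set; positivity enters only here.
lemma stickProd_logChar {B : ℝ} {n : ℤ} (hL : 0 < L) {c : Stick k R → (Fin (k - 1) → ℝ)}
    (hc : ∀ u (j : Fin k), 0 < gap (c u) j) (p : Stick k R) :
    stickProd (logChar B n) L c p = logChar B n (len L c p) := by
  induction p using stick_induction with
  | root i => rfl
  | step u j ih =>
    rw [stickProd_child, ih, len_child, logChar_mul (len_pos hL hc u) (hc u j)]

variable {χ} in
lemma measurable_stickProd (hχ : Measurable χ) (p : Stick k R) :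
    Measurable fun c : Stick k R → (Fin (k - 1) → ℝ) => stickProd χ L c p := by
  induction p using stick_induction with
  | root i => exact measurable_const
  | step u j ih =>
    simp only [stickProd_child]
    exact ih.mul (hχ.comp ((measurable_gap j).comp (measurable_pi_apply u)))

variable {χ} in
lemma norm_stickProd_le (hχ : ∀ x, ‖χ x‖ ≤ 1) (c : Stick k R → (Fin (k - 1) → ℝ))
    (p : Stick k R) : ‖stickProd χ L c p‖ ≤ 1 := by
  induction p using stick_induction with
  | root i => exact hχ L
  | step u j ih =>
    rw [stickProd_child, norm_mul]
    exact mul_le_one₀ ih (norm_nonneg _) (hχ _)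

/-- Only the cuts of strict ancestors of `q` matter, so `q = p` is allowed, unlike in
`alive_update`. -/
lemma stickProd_update {c : Stick k R → (Fin (k - 1) → ℝ)} {p q : Stick k R}
    {y : Fin (k - 1) → ℝ} (hl : q.2.length ≤ p.2.length) :
    stickProd χ L (Function.update c p y) q = stickProd χ L c q := by
  induction q using stick_induction with
  | root i => rfl
  | step u j ih =>
    have hlt : u.2.length < p.2.length := Nat.lt_of_succ_le hl
    rw [stickProd_child, stickProd_child, ih hlt.le,
      Function.update_of_ne (fun h => by simp [h] at hlt)]

/-- The sum over the sticks `u ∈ T` of the weighted innovations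
`χ (gap (c u) j) - 𝔼 χ (gap · j)`. -/
noncomputable def innovationSum (D : Measure (Fin (k - 1) → ℝ)) (b : Stick k R → Fin k → ℂ)
    (T : Finset (Stick k R)) (c : Stick k R → (Fin (k - 1) → ℝ)) : ℂ :=
  ∑ u ∈ T, ∑ j, b u j * (stickProd χ L c u * (χ (gap (c u) j) - ∫ x, χ (gap x j) ∂D))

variable {χ} in
lemma measurable_innovationSum (hχ : Measurable χ) (D : Measure (Fin (k - 1) → ℝ))
    (b : Stick k R → Fin k → ℂ) (T : Finset (Stick k R)) :
    Measurable (innovationSum χ L D b T) := by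
  refine Finset.measurable_sum _ fun u _ => Finset.measurable_sum _ fun j _ => ?_
  exact ((measurable_stickProd L hχ u).mul
    ((hχ.comp ((measurable_gap j).comp (measurable_pi_apply u))).sub_const _)).const_mul _

variable {χ} in
-- The term of `u` is a martingale difference: `stickProd χ L c u` does not see the cut of `u`, and
-- the bracket is centred. It is bounded by `2 * k * K`: `k` pieces, weight at most `K`, bracket at
-- most `2`.
lemma measure_re_innovationSum_ge_le (hχ : Measurable χ) (hχ1 : ∀ x, ‖χ x‖ ≤ 1)
    (D : Measure (Fin (k - 1) → ℝ)) [IsProbabilityMeasure D] (b : Stick k R → Fin k → ℂ)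
    (hk : 0 < k) {K ε N : ℝ} (hb : ∀ u j, ‖b u j‖ ≤ K) (hK : 0 < K) (hε : 0 < ε)
    (hεK : ε ≤ 2 * k * K) (T : Finset (Stick k R)) (hN : (T.card : ℝ) ≤ N) :
    (Measure.infinitePi fun _ : Stick k R => D) {c | ε * N ≤ (innovationSum χ L D b T c).re} ≤
      ENNReal.ofReal (Real.exp (-(ε ^ 2 / (4 * (2 * k * K) ^ 2)) * N)) := by
  set φ : Fin k → ℂ := fun j => ∫ x, χ (gap x j) ∂D with hφ
  have hφ1 : ∀ j, ‖φ j‖ ≤ 1 := fun j => by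
    simpa using norm_integral_le_of_norm_le_const (μ := D) (ae_of_all D fun x => hχ1 (gap x j))
  have hint : ∀ j : Fin k, Integrable (fun x => χ (gap x j)) D := fun j =>
    Integrable.of_bound (hχ.comp (measurable_gap j)).aestronglyMeasurable 1
      (ae_of_all _ fun x => hχ1 _)
  set Δc : Stick k R → (Stick k R → (Fin (k - 1) → ℝ)) → ℂ := fun u c =>
    ∑ j, b u j * (stickProd χ L c u * (χ (gap (c u) j) - φ j)) with hΔc
  have hmc : ∀ u, Measurable (Δc u) := fun u => by
    have h := measurable_innovationSum L hχ D b {u}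
    unfold innovationSum at h
    simpa only [Finset.sum_singleton] using! h
  have hself : ∀ p c y, Δc p (Function.update c p y) =
      ∑ j, b p j * (stickProd χ L c p * (χ (gap y j) - φ j)) := fun p c y => by
    simp only [hΔc, stickProd_update χ L le_rfl, Function.update_self]
  have hkey := measure_sum_ge_le D (fun p : Stick k R => p.2.length) (fun u c => (Δc u c).re)
    (fun u => Complex.measurable_re.comp (hmc u)) (K := 2 * k * K) (ε := ε) ?_ ?_ ?_
    (by positivity) hε hεK T hN
  · have h : ∀ c, (innovationSum χ L D b T c).re = ∑ p ∈ T, (Δc p c).re := fun c =>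
      Complex.re_sum _ _
    simpa only [h] using hkey
  · intro u c
    refine (Complex.abs_re_le_norm _).trans ((norm_sum_le _ _).trans ?_)
    have : ∀ j ∈ (Finset.univ : Finset (Fin k)),
        ‖b u j * (stickProd χ L c u * (χ (gap (c u) j) - φ j))‖ ≤ K * (1 * 2) := fun j _ => by
      rw [norm_mul, norm_mul]
      have h2 : ‖χ (gap (c u) j) - φ j‖ ≤ 2 :=
        (norm_sub_le _ _).trans (by linarith [hχ1 (gap (c u) j), hφ1 j])
      exact mul_le_mul (hb u j) (mul_le_mul (norm_stickProd_le L hχ1 c u) h2 (norm_nonneg _)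
        zero_le_one) (by positivity) hK.le
    refine (Finset.sum_le_sum this).trans (le_of_eq ?_)
    simp; ring
  · intro p q c y hl hne
    simp only [hΔc, stickProd_update χ L hl, Function.update_of_ne hne]
  · intro p c
    simp only [hself]
    have hi : ∀ j ∈ (Finset.univ : Finset (Fin k)), Integrable
        (fun y => b p j * (stickProd χ L c p * (χ (gap y j) - φ j))) D := fun j _ =>
      (((hint j).sub (integrable_const _)).const_mul _).const_mul _
    have h0 : ∫ y, ∑ j, b p j * (stickProd χ L c p * (χ (gap y j) - φ j)) ∂D = 0 := by
      rw [integral_finsetSum _ hi]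
      refine Finset.sum_eq_zero fun j _ => ?_
      rw [integral_const_mul, integral_const_mul, integral_sub (hint j) (integrable_const _)]
      simp [hφ]
    have h1 := integral_re (integrable_finsetSum _ hi)
    rw [h0] at h1
    simpa using! h1

variable {χ} in
/-- The sum of innovations over at most `N` sticks is rarely of order `N`. -/
lemma measure_norm_innovationSum_ge_le (hχ : Measurable χ) (hχ1 : ∀ x, ‖χ x‖ ≤ 1)
    (D : Measure (Fin (k - 1) → ℝ)) [IsProbabilityMeasure D] (b : Stick k R → Fin k → ℂ)
    (hk : 0 < k) {K ε N : ℝ} (hb : ∀ u j, ‖b u j‖ ≤ K) (hK : 0 < K) (hε : 0 < ε)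
    (hεK : ε ≤ 2 * k * K) (T : Finset (Stick k R)) (hN : (T.card : ℝ) ≤ N) :
    (Measure.infinitePi fun _ : Stick k R => D)
      {c | 2 * ε * N ≤ ‖innovationSum χ L D b T c‖} ≤
      4 * ENNReal.ofReal (Real.exp (-(ε ^ 2 / (4 * (2 * k * K) ^ 2)) * N)) := by
  have hmul : ∀ (w : ℂ) c, innovationSum χ L D (fun u j => w * b u j) T c =
      w * innovationSum χ L D b T c := fun w c => by
    simp only [innovationSum, Finset.mul_sum, mul_assoc]
  have hw : ∀ w : ℂ, ‖w‖ = 1 → (Measure.infinitePi fun _ : Stick k R => D)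
      {c | ε * N ≤ (w * innovationSum χ L D b T c).re} ≤
      ENNReal.ofReal (Real.exp (-(ε ^ 2 / (4 * (2 * k * K) ^ 2)) * N)) := fun w hw => by
    simp only [← hmul]
    exact measure_re_innovationSum_ge_le L hχ hχ1 D _ hk
      (fun u j => by rw [norm_mul, hw, one_mul]; exact hb u j) hK hε hεK T hN
  -- A complex number of modulus at least `2 * ε * N` has real or imaginary part of absolute value
  -- at least `ε * N`. The rotations by `±1` and `±I` are absorbed into the weights `b`.
  have hsub : {c | 2 * ε * N ≤ ‖innovationSum χ L D b T c‖} ⊆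
      ({c | ε * N ≤ (1 * innovationSum χ L D b T c).re} ∪
        {c | ε * N ≤ (-1 * innovationSum χ L D b T c).re}) ∪
      ({c | ε * N ≤ (Complex.I * innovationSum χ L D b T c).re} ∪
        {c | ε * N ≤ (-Complex.I * innovationSum χ L D b T c).re}) := fun c hc => by
    have h1 := Complex.norm_le_abs_re_add_abs_im (innovationSum χ L D b T c)
    simp only [Set.mem_ofPred_eq] at hc
    simp only [Set.mem_union, Set.mem_ofPred_eq, one_mul, neg_mul, Complex.neg_re, Complex.mul_re,
      Complex.I_re, Complex.I_im, zero_mul, zero_sub, neg_neg]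
    by_contra! h
    obtain ⟨⟨h2, h3⟩, h4, h5⟩ := h
    have h6 : |(innovationSum χ L D b T c).re| < ε * N := abs_lt.2 ⟨by linarith, h2⟩
    have h7 : |(innovationSum χ L D b T c).im| < ε * N := abs_lt.2 ⟨by linarith, h5⟩
    linarith
  refine (measure_mono hsub).trans ((measure_union_le _ _).trans ((add_le_add
    ((measure_union_le _ _).trans (add_le_add (hw 1 (by simp)) (hw (-1) (by simp))))
    ((measure_union_le _ _).trans (add_le_add (hw _ (by simp)) (hw _ (by simp))))).trans
    (le_of_eq ?_)))
  ring

end Path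

/-! ### Finite trees of living sticks and their dead leaves -/

section Tree

variable {k R : ℕ} {T : Finset (Stick k R)}

/-- The initial sticks and the pieces of the sticks in `T`. -/
def existing (T : Finset (Stick k R)) : Finset (Stick k R) := roots k R ∪ children T

/-- The sticks that come into existence when exactly the sticks in `T` break, and do not break. -/
def leaves (T : Finset (Stick k R)) : Finset (Stick k R) := existing T \ T

lemma leaves_subset_existing : leaves T ⊆ existing T := Finset.sdiff_subset

lemma disjoint_roots_children (T : Finset (Stick k R)) : Disjoint (roots k R) (children T) := by
  rw [Finset.disjoint_left]
  intro p hp hc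
  obtain ⟨u, -, j, rfl⟩ := mem_children.1 hc
  simp [mem_roots, child] at hp

lemma sum_existing {M : Type*} [AddCommMonoid M] (f : Stick k R → M) :
    ∑ p ∈ existing T, f p = ∑ i, f (i, []) + ∑ u ∈ T, ∑ j, f (child u j) := by
  rw [existing, Finset.sum_union (disjoint_roots_children T), sum_roots, sum_children]

lemma child_mem_existing {u : Stick k R} {j : Fin k} : child u j ∈ existing T ↔ u ∈ T := by
  rw [existing, Finset.mem_union, child_mem_children, mem_roots]
  simp [child]

lemma root_mem_existing (i : Fin R) : (i, []) ∈ existing T :=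
  Finset.mem_union_left _ (mem_roots.2 rfl)

/-- Both sides count the existing sticks. The hypothesis `T ⊆ existing T` says that `T` is closed
under taking parents. -/
lemma card_leaves_add (hT : T ⊆ existing T) : (leaves T).card + T.card = R + T.card * k := by
  rw [leaves, Finset.card_sdiff_add_card_eq_card hT, existing,
    Finset.card_union_of_disjoint (disjoint_roots_children T), card_roots, card_children]

lemma le_card_leaves (hk : 2 ≤ k) (hT : T ⊆ existing T) : R ≤ (leaves T).card := by
  have h1 := card_leaves_add hT
  have h2 : T.card * 1 ≤ T.card * k := Nat.mul_le_mul_left _ (by omega)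
  omega

lemma card_le_card_leaves (hk : 2 ≤ k) (hT : T ⊆ existing T) : T.card ≤ (leaves T).card := by
  have h1 := card_leaves_add hT
  have h2 : T.card * 2 ≤ T.card * k := Nat.mul_le_mul_left _ hk
  omega

/-- The total weight of the leaves `i` levels below a stick, where the `j`-th piece of every stick
carries the factor `φ j`. -/
noncomputable def leafWeight (φ : Fin k → ℂ) (T : Finset (Stick k R)) : ℕ → Stick k R → ℂ
  | 0, p => if p ∈ leaves T then 1 else 0
  | i + 1, p => ∑ j, φ j * leafWeight φ T i (child p j)

lemma leafWeight_eq_zero (φ : Fin k → ℂ) (hT : T ⊆ existing T) {i : ℕ} {p : Stick k R}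
    (hp : p ∉ existing T) : leafWeight φ T i p = 0 := by
  induction i generalizing p with
  | zero => exact if_neg fun h => hp (Finset.mem_sdiff.1 h).1
  | succ i ih =>
    refine Finset.sum_eq_zero fun j _ => ?_
    rw [ih fun h => hp (hT (child_mem_existing.1 h)), mul_zero]

lemma leafWeight_succ_eq_zero (φ : Fin k → ℂ) (hT : T ⊆ existing T) {i : ℕ} {p : Stick k R}
    (hp : p ∉ T) : leafWeight φ T (i + 1) p = 0 := by
  refine Finset.sum_eq_zero fun j _ => ?_
  rw [leafWeight_eq_zero φ hT fun h => hp (child_mem_existing.1 h), mul_zero]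

lemma norm_leafWeight_le {φ : Fin k → ℂ} (hφ : ∀ j, ‖φ j‖ ≤ 1) (i : ℕ) (p : Stick k R) :
    ‖leafWeight φ T i p‖ ≤ (k : ℝ) ^ i := by
  induction i generalizing p with
  | zero => simp only [leafWeight]; split_ifs <;> simp
  | succ i ih =>
    refine (norm_sum_le_of_le _ fun j _ => ?_).trans (b := ∑ _j : Fin k, (k : ℝ) ^ i)
      (le_of_eq (by simp [pow_succ']))
    rw [norm_mul]
    exact (mul_le_of_le_one_left (norm_nonneg _) (hφ j)).trans (ih _)

/-- Each leaf has at most one ancestor `i` levels up, so it is counted at most once, with a product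
of `i` factors of modulus at most `ρ`. -/
lemma sum_norm_leafWeight_le {φ : Fin k → ℂ} {ρ : ℝ} (hρ : 0 ≤ ρ) (hφ : ∀ j, ‖φ j‖ ≤ ρ)
    (hT : T ⊆ existing T) (i : ℕ) :
    ∑ p ∈ existing T, ‖leafWeight φ T i p‖ ≤ ρ ^ i * (leaves T).card := by
  induction i with
  | zero =>
    simp only [leafWeight, apply_ite norm, norm_one, norm_zero, pow_zero, one_mul]
    rw [Finset.sum_ite_mem, Finset.inter_eq_right.2 leaves_subset_existing]
    simp
  | succ i ih =>
    rw [← Finset.sum_subset hT fun p _ hp => by rw [leafWeight_succ_eq_zero φ hT hp, norm_zero]]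
    calc ∑ u ∈ T, ‖leafWeight φ T (i + 1) u‖
        ≤ ∑ u ∈ T, ∑ j, ρ * ‖leafWeight φ T i (child u j)‖ :=
          Finset.sum_le_sum fun u _ => norm_sum_le_of_le _ fun j _ => by
            rw [norm_mul]; exact mul_le_mul_of_nonneg_right (hφ j) (norm_nonneg _)
      _ ≤ ρ * ∑ p ∈ existing T, ‖leafWeight φ T i p‖ := by
          rw [sum_existing, mul_add]
          simp_rw [Finset.mul_sum]
          exact le_add_of_nonneg_left (Finset.sum_nonneg fun _ _ => by positivity)
      _ ≤ ρ ^ (i + 1) * (leaves T).card := by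
          rw [pow_succ', mul_assoc]
          exact mul_le_mul_of_nonneg_left ih hρ

variable (χ : ℝ → ℂ) (L : ℝ) (D : Measure (Fin (k - 1) → ℝ))

/-- The innovations that occur `i` levels above the leaves. -/
noncomputable def innovation (i : ℕ) (T : Finset (Stick k R))
    (c : Stick k R → (Fin (k - 1) → ℝ)) : ℂ :=
  innovationSum χ L D (fun u j => leafWeight (fun j => ∫ x, χ (gap x j) ∂D) T i (child u j)) T c

/-- One averaging step: an existing stick is either initial or a piece `j` of some `u ∈ T`. In the
latter case `χ (gap (c u) j)` is split into its mean, which moves into the weight of `u`, and an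
innovation. -/
lemma sum_leafWeight_mul_stickProd (hT : T ⊆ existing T) (c : Stick k R → (Fin (k - 1) → ℝ))
    (i : ℕ) :
    ∑ p ∈ existing T, leafWeight (fun j => ∫ x, χ (gap x j) ∂D) T i p * stickProd χ L c p =
      ∑ r, leafWeight (fun j => ∫ x, χ (gap x j) ∂D) T i (r, []) * χ L + innovation χ L D i T c +
      ∑ p ∈ existing T,
        leafWeight (fun j => ∫ x, χ (gap x j) ∂D) T (i + 1) p * stickProd χ L c p := by
  rw [← Finset.sum_subset (f := fun p => leafWeight _ T (i + 1) p * stickProd χ L c p) hT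
    fun p _ hp => by rw [leafWeight_succ_eq_zero _ hT hp, zero_mul]]
  rw [sum_existing, add_assoc, innovation, innovationSum, ← Finset.sum_add_distrib]
  simp only [stickProd_root]
  congr 1
  refine Finset.sum_congr rfl fun u _ => ?_
  rw [leafWeight, Finset.sum_mul, ← Finset.sum_add_distrib]
  refine Finset.sum_congr rfl fun j _ => ?_
  rw [stickProd_child]
  ring

variable {χ} in
-- The averaging step is iterated `d` times from weight `1` on the leaves. The initial sticks split
-- off at step `i` account for the leaves of level `i`, at most `k ^ i` below each.
lemma norm_sum_leaves_le (hχ1 : ∀ x, ‖χ x‖ ≤ 1) {ρ : ℝ} (hρ : 0 ≤ ρ) (hρ1 : ρ ≤ 1)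
    (hφ : ∀ j : Fin k, ‖∫ x, χ (gap x j) ∂D‖ ≤ ρ) (hT : T ⊆ existing T)
    (c : Stick k R → (Fin (k - 1) → ℝ)) (d : ℕ) :
    ‖∑ p ∈ leaves T, stickProd χ L c p‖ ≤
      R * ∑ i ∈ Finset.range d, (k : ℝ) ^ i + ∑ i ∈ Finset.range d, ‖innovation χ L D i T c‖ +
        ρ ^ d * (leaves T).card := by
  set φ : Fin k → ℂ := fun j => ∫ x, χ (gap x j) ∂D
  have h0 : ∑ p ∈ leaves T, stickProd χ L c p =
      ∑ p ∈ existing T, leafWeight φ T 0 p * stickProd χ L c p := by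
    simp only [leafWeight, ite_mul, one_mul, zero_mul]
    rw [Finset.sum_ite_mem, Finset.inter_eq_right.2 leaves_subset_existing]
  have h1 : ∀ d, ‖∑ p ∈ leaves T, stickProd χ L c p‖ ≤
      R * ∑ i ∈ Finset.range d, (k : ℝ) ^ i + ∑ i ∈ Finset.range d, ‖innovation χ L D i T c‖ +
        ‖∑ p ∈ existing T, leafWeight φ T d p * stickProd χ L c p‖ := fun d => by
    induction d with
    | zero => simp [h0]
    | succ d ih =>
      rw [sum_leafWeight_mul_stickProd χ L D hT] at ih
      rw [Finset.sum_range_succ, Finset.sum_range_succ, mul_add]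
      have h2 : ‖∑ r : Fin R, leafWeight φ T d (r, []) * χ L‖ ≤ R * (k : ℝ) ^ d := by
        refine (norm_sum_le_of_le _ fun r _ => ?_).trans (b := ∑ _r : Fin R, (k : ℝ) ^ d)
          (le_of_eq (by simp))
        rw [norm_mul]
        exact (mul_le_of_le_one_right (norm_nonneg _) (hχ1 L)).trans
          (norm_leafWeight_le (fun j => (hφ j).trans hρ1) d _)
      have h3 := norm_add₃_le (a := ∑ r : Fin R, leafWeight φ T d (r, []) * χ L)
        (b := innovation χ L D d T c)
        (c := ∑ p ∈ existing T, leafWeight φ T (d + 1) p * stickProd χ L c p)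
      linarith
  refine (h1 d).trans (add_le_add le_rfl ((norm_sum_le_of_le _ fun p _ => ?_).trans
    (sum_norm_leafWeight_le hρ hφ hT d)))
  rw [norm_mul]
  exact mul_le_of_le_one_right (norm_nonneg _) (norm_stickProd_le L hχ1 c p)

end Tree

/-! ### The tree of living sticks -/

section AliveTree

variable {k R : ℕ} {a : Stick k R → Bool}

lemma not_alive_of_le {n m : ℕ} (hn : ∀ p ∈ levelSet k R n, ¬ Alive a p) (hm : n ≤ m) :
    ∀ p ∈ levelSet k R m, ¬ Alive a p := by
  induction m, hm using Nat.le_induction with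
  | base => exact hn
  | succ m _ ih =>
    intro p hp
    rw [levelSet, mem_children] at hp
    obtain ⟨u, hu, j, rfl⟩ := hp
    exact fun h => ih u hu ((alive_child a u j).1 h).1

/-- If the process terminates, the living sticks form a finite set. -/
lemma exists_aliveTree (h : Terminates a) : ∃ T : Finset (Stick k R), ∀ p, p ∈ T ↔ Alive a p := by
  obtain ⟨n, hn⟩ := terminates_iff.1 h
  have hfin : {p | Alive a p}.Finite :=
    ((Finset.range n).biUnion (levelSet k R)).finite_toSet.subset fun p hp => by
      simp only [Finset.coe_biUnion, Set.mem_iUnion, Finset.mem_coe, Finset.mem_range]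
      refine ⟨p.2.length, ?_, mem_levelSet.2 rfl⟩
      by_contra! hlt
      exact not_alive_of_le hn hlt p (mem_levelSet.2 rfl) hp
  exact ⟨hfin.toFinset, fun p => by simp⟩

variable {T : Finset (Stick k R)}

lemma subset_existing (hT : ∀ p, p ∈ T ↔ Alive a p) : T ⊆ existing T := fun p hp => by
  cases p using stick_induction with
  | root i => exact root_mem_existing i
  | step u j => exact child_mem_existing.2 ((hT u).2 ((alive_child a u j).1 ((hT _).1 hp)).1)

lemma isDead_iff (hT : ∀ p, p ∈ T ↔ Alive a p) (p : Stick k R) :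
    IsDead (fun u => a (p.1, u)) p.2 ↔ p ∈ leaves T := by
  rw [leaves, Finset.mem_sdiff, hT]
  cases p using stick_induction with
  | root i => exact iff_of_false id fun h => h.2 (alive_root a i)
  | step u j =>
    rw [isDead_child, child_mem_existing, hT, alive_child]
    cases a (child u j) <;> simp

lemma sum_aliveCount_le (hT : ∀ p, p ∈ T ↔ Alive a p) (M : ℕ) :
    ∑ n ∈ Finset.range M, aliveCount a n ≤ T.card := by
  classical
  unfold aliveCount
  rw [← Finset.card_biUnion]
  · exact Finset.card_le_card fun p hp => by
      simp only [Finset.mem_biUnion, Finset.mem_filter] at hp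
      obtain ⟨n, -, -, h⟩ := hp
      exact (hT p).2 h
  · intro n _ m _ hnm
    rw [Function.onFun, Finset.disjoint_left]
    intro p hp hp'
    simp only [Finset.mem_filter, mem_levelSet] at hp hp'
    exact hnm (hp.1.symm.trans hp'.1)

end AliveTree

/-! ### Averages of characters over the ending sticks, for one realization -/

section Deterministic

variable {k : ℕ} {L : ℝ} {D : Measure (Fin (k - 1) → ℝ)} {χ : ℝ → ℂ}
  {a : ∀ R, Stick k R → Bool} {T : ∀ R, Finset (Stick k R)}
  {c : ∀ R, Stick k R → (Fin (k - 1) → ℝ)}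

/-- The first `M` levels already contain at least `M * R / 2` living sticks once `R` is large, and
there are at least as many leaves as living sticks. -/
lemma tendsto_div_card_leaves (hk : 2 ≤ k) (hT : ∀ R p, p ∈ T R ↔ Alive (a R) p)
    (hA : ∀ n, ∀ᶠ R in atTop, R < 2 * aliveCount (a R) n) :
    Tendsto (fun R : ℕ => (R : ℝ) / (leaves (T R)).card) atTop (𝓝 0) := by
  rw [Metric.tendsto_atTop]
  intro ε hε
  obtain ⟨M, hM⟩ := exists_nat_gt (2 / ε)
  have hev : ∀ᶠ R in atTop, ∀ n ∈ Finset.range M, R < 2 * aliveCount (a R) n :=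
    (Filter.eventually_all_finset _).2 fun n _ => hA n
  obtain ⟨R₀, hR₀⟩ := eventually_atTop.1 hev
  refine ⟨max R₀ 1, fun R hR => ?_⟩
  have hR1 : 0 < R := lt_of_lt_of_le one_pos ((le_max_right _ _).trans hR)
  have hsub := subset_existing (hT R)
  have hN0 : (0 : ℝ) < (leaves (T R)).card := by
    exact_mod_cast hR1.trans_le (le_card_leaves hk hsub)
  have h1 : M * R ≤ 2 * (leaves (T R)).card := by
    calc M * R = ∑ _n ∈ Finset.range M, R := by simp
      _ ≤ ∑ n ∈ Finset.range M, 2 * aliveCount (a R) n :=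
        Finset.sum_le_sum fun n hn => (hR₀ R ((le_max_left _ _).trans hR) n hn).le
      _ ≤ 2 * (leaves (T R)).card := by
        rw [← Finset.mul_sum]
        exact Nat.mul_le_mul_left _
          ((sum_aliveCount_le (hT R) M).trans (card_le_card_leaves hk hsub))
  have h2 : (M : ℝ) * R ≤ 2 * (leaves (T R)).card := by exact_mod_cast h1
  rw [dist_zero_right, Real.norm_of_nonneg (by positivity), div_lt_iff₀ hN0]
  have hR1' : (0 : ℝ) < R := by exact_mod_cast hR1
  rw [div_lt_iff₀ hε] at hM
  nlinarith

/-- The depth `d` is fixed first, to make `ρ ^ d` small; then `R → ∞` removes the other two errors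
of `norm_sum_leaves_le`. -/
lemma tendsto_average_stickProd (hk : 2 ≤ k) (hT : ∀ R p, p ∈ T R ↔ Alive (a R) p)
    (hN : Tendsto (fun R : ℕ => (R : ℝ) / (leaves (T R)).card) atTop (𝓝 0))
    (hχ1 : ∀ x, ‖χ x‖ ≤ 1) (hφ : ∀ j : Fin k, ‖∫ x, χ (gap x j) ∂D‖ < 1)
    (hI : ∀ i m : ℕ, ∀ᶠ R in atTop,
      ‖innovation χ L D i (T R) (c R)‖ < 1 / (m + 1 : ℝ) * (leaves (T R)).card) :
    Tendsto (fun R => (∑ p ∈ leaves (T R), stickProd χ L (c R) p) / (leaves (T R)).card)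
      atTop (𝓝 0) := by
  obtain ⟨ρ, hρ0, hρ1, hρ⟩ : ∃ ρ : ℝ, 0 ≤ ρ ∧ ρ < 1 ∧ ∀ j : Fin k, ‖∫ x, χ (gap x j) ∂D‖ ≤ ρ := by
    have hne : (Finset.univ : Finset (Fin k)).Nonempty := ⟨⟨0, by omega⟩, Finset.mem_univ _⟩
    refine ⟨Finset.univ.sup' hne fun j : Fin k => ‖∫ x, χ (gap x j) ∂D‖, ?_, ?_, fun j =>
      Finset.le_sup' (fun j : Fin k => ‖∫ x, χ (gap x j) ∂D‖) (Finset.mem_univ j)⟩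
    · exact (norm_nonneg _).trans
        (Finset.le_sup' (fun j : Fin k => ‖∫ x, χ (gap x j) ∂D‖) (Finset.mem_univ ⟨0, by omega⟩))
    · rw [Finset.sup'_lt_iff]
      exact fun j _ => hφ j
  have hI0 : ∀ i, Tendsto (fun R => ‖innovation χ L D i (T R) (c R)‖ / (leaves (T R)).card)
      atTop (𝓝 0) := fun i => by
    rw [Metric.tendsto_nhds]
    intro ε hε
    obtain ⟨m, hm⟩ := exists_nat_one_div_lt hε
    filter_upwards [hI i m] with R hR
    -- The strict inequality `hR` excludes an empty set of leaves.
    have hN0 : (0 : ℝ) < (leaves (T R)).card := by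
      by_contra! h
      have := mul_nonpos_of_nonneg_of_nonpos (a := 1 / (m + 1 : ℝ)) (by positivity) h
      linarith [norm_nonneg (innovation χ L D i (T R) (c R))]
    rw [dist_zero_right, Real.norm_of_nonneg (by positivity), div_lt_iff₀ hN0]
    exact hR.trans (mul_lt_mul_of_pos_right hm hN0)
  rw [Metric.tendsto_nhds]
  intro ε hε
  obtain ⟨d, hd⟩ := exists_pow_lt_of_lt_one (half_pos hε) hρ1
  have hlim : Tendsto (fun R : ℕ => (R : ℝ) / (leaves (T R)).card *
      (∑ i ∈ Finset.range d, (k : ℝ) ^ i) +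
      ∑ i ∈ Finset.range d, ‖innovation χ L D i (T R) (c R)‖ / (leaves (T R)).card)
      atTop (𝓝 (0 * (∑ i ∈ Finset.range d, (k : ℝ) ^ i) + ∑ i ∈ Finset.range d, 0)) :=
    (hN.mul_const _).add (tendsto_finsetSum _ fun i _ => hI0 i)
  rw [zero_mul, Finset.sum_const_zero, add_zero] at hlim
  filter_upwards [hlim.eventually (gt_mem_nhds (half_pos hε)), eventually_gt_atTop 0] with R hR hR0
  have hsub := subset_existing (hT R)
  have hN0 : (0 : ℝ) < (leaves (T R)).card := by
    exact_mod_cast hR0.trans_le (le_card_leaves hk hsub)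
  have h := norm_sum_leaves_le L D hχ1 hρ0 hρ1.le hρ hsub (c R) d
  rw [dist_zero_right, norm_div, Complex.norm_natCast, div_lt_iff₀ hN0]
  refine h.trans_lt ?_
  rw [← Finset.sum_div, div_mul_eq_mul_div, ← add_div, div_lt_iff₀ hN0] at hR
  nlinarith

end Deterministic

/-! ### Almost sure statements -/

section AlmostSure

variable {k R : ℕ} {Ω : Type*} [MeasurableSpace Ω] {μ : Measure Ω}
  {D : Measure (Fin (k - 1) → ℝ)}

lemma IsFragmentation.map_cut {r : ℝ} {cut : Stick k R → Ω → (Fin (k - 1) → ℝ)}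
    {status : Stick k R → Ω → Bool} (h : IsFragmentation μ D r cut status) :
    μ.map (fun ω p => cut p ω) = Measure.infinitePi fun _ : Stick k R => D := by
  have h1 := h.indep_cut.map_fun_eq_infinitePi_map h.measurable_cut
  simpa only [h.law_cut] using h1

lemma IsFragmentation.ae_gap_pos (hD : IsGood D) {r : ℝ}
    {cut : Stick k R → Ω → (Fin (k - 1) → ℝ)}
    {status : Stick k R → Ω → Bool} (h : IsFragmentation μ D r cut status) :
    ∀ᵐ ω ∂μ, ∀ u (j : Fin k), 0 < gap (cut u ω) j := by
  rw [ae_all_iff]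
  intro u
  rw [ae_all_iff]
  intro j
  have h1 := hD.ae_gap_pos (i := j) (by have := j.2; omega)
  rw [← h.law_cut u] at h1
  exact ae_of_ae_map (h.measurable_cut u).aemeasurable h1

lemma measure_bool_ext {ν₁ ν₂ : Measure Bool} [IsProbabilityMeasure ν₁] [IsProbabilityMeasure ν₂]
    (h : ν₁ {true} = ν₂ {true}) : ν₁ = ν₂ := by
  refine Measure.ext_of_singleton fun b => ?_
  cases b
  · have : ({false} : Set Bool) = {true}ᶜ := by ext b; cases b <;> simp
    rw [this, prob_compl_eq_one_sub (MeasurableSet.singleton _),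
      prob_compl_eq_one_sub (MeasurableSet.singleton _), h]
  · exact h

variable [IsProbabilityMeasure μ]

lemma exists_statusLaw (hk : 2 ≤ k) : ∃ ν : Measure Bool, IsProbabilityMeasure ν ∧
    ν {true} = ENNReal.ofReal (1 / k) ∧
    ∀ {R : ℕ} {cut : Stick k R → Ω → (Fin (k - 1) → ℝ)} {status : Stick k R → Ω → Bool},
      IsFragmentation μ D (1 / k) cut status →
      μ.map (fun ω p => status p ω) = Measure.infinitePi fun _ : Stick k R => ν := by
  have hk1 : (1 : ℝ) / k ≤ 1 := by
    rw [div_le_one (by positivity)]; exact_mod_cast (by omega : 1 ≤ k)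
  set ν : Measure Bool := ENNReal.ofReal (1 / k) • Measure.dirac true +
    ENNReal.ofReal (1 - 1 / k) • Measure.dirac false with hν
  have hν1 : IsProbabilityMeasure ν := ⟨by
    simp only [hν, Measure.add_apply, Measure.smul_apply, measure_univ, smul_eq_mul, mul_one]
    rw [← ENNReal.ofReal_add (by positivity) (by linarith)]
    simp⟩
  have hν2 : ν {true} = ENNReal.ofReal (1 / k) := by simp [hν]
  refine ⟨ν, hν1, hν2, fun {R cut status} h => ?_⟩
  have h1 := h.indep_status.map_fun_eq_infinitePi_map h.measurable_status
  have h2 : ∀ p, μ.map (status p) = ν := fun p => by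
    have := Measure.isProbabilityMeasure_map (μ := μ) (h.measurable_status p).aemeasurable
    refine measure_bool_ext ?_
    rw [Measure.map_apply (h.measurable_status p) (MeasurableSet.singleton _), hν2]
    exact h.law_status p
  simpa only [h2] using h1

lemma IsFragmentation.ae_terminates (hk : 2 ≤ k) {cut : Stick k R → Ω → (Fin (k - 1) → ℝ)}
    {status : Stick k R → Ω → Bool} (h : IsFragmentation μ D (1 / k) cut status) :
    ∀ᵐ ω ∂μ, Terminates fun p => status p ω := by
  obtain ⟨ν, hν1, hν, hlaw⟩ := exists_statusLaw (μ := μ) (D := D) hk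
  have h1 := StickFragmentation.ae_terminates (k := k) (R := R) ν hk hν
  rw [← hlaw h] at h1
  exact ae_of_ae_map (measurable_pi_lambda _ h.measurable_status).aemeasurable h1

variable {cut : ∀ R : ℕ, Stick k R → Ω → (Fin (k - 1) → ℝ)}
  {status : ∀ R : ℕ, Stick k R → Ω → Bool}

/-- Borel–Cantelli in its summable form uses only the law for each single `R`, hence no assumption
on the joint law. -/
lemma ae_eventually_lt_aliveCount (hk : 2 ≤ k)
    (hproc : ∀ R, IsFragmentation μ D (1 / k) (cut R) (status R)) :
    ∀ᵐ ω ∂μ, ∀ n, ∀ᶠ R in atTop, R < 2 * aliveCount (fun p => status R p ω) n := by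
  rw [ae_all_iff]
  intro n
  obtain ⟨ν, hν1, hν, hlaw⟩ := exists_statusLaw (μ := μ) (D := D) hk
  obtain ⟨q, hq0, hq1, hq⟩ := exists_measure_aliveCount_le (k := k) hk n
  have hle : ∀ R, μ {ω | 2 * aliveCount (fun p => status R p ω) n ≤ R} ≤ ENNReal.ofReal (q ^ R) :=
    fun R => by
      have h1 := hq R ν hν
      rw [← hlaw (hproc R)] at h1
      -- This inequality holds for arbitrary sets, so measurability of `aliveCount` is not needed.
      exact (Measure.le_map_apply
        (measurable_pi_lambda _ (hproc R).measurable_status).aemeasurable _).trans h1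
  have hsum : ∑' R, μ {ω | 2 * aliveCount (fun p => status R p ω) n ≤ R} ≠ ∞ := by
    refine ne_top_of_le_ne_top ?_ (ENNReal.tsum_le_tsum hle)
    rw [← ENNReal.ofReal_tsum_of_nonneg (fun R => pow_nonneg hq0 R)
      (summable_geometric_of_lt_one hq0 hq1)]
    exact ENNReal.ofReal_ne_top
  filter_upwards [ae_eventually_notMem hsum] with ω hω
  filter_upwards [hω] with R hR
  simpa using hR

/-- The event is decomposed over the countably many finite trees `T`. By independence of cuts and
statuses, the Chernoff bound for fixed `T` multiplies the probability that `T` is the tree, and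
these probabilities add up to at most `1`. -/
lemma measure_innovation_ge_le (hk : 2 ≤ k) {χ : ℝ → ℂ} (hχ : Measurable χ)
    (hχ1 : ∀ x, ‖χ x‖ ≤ 1) (L : ℝ) [IsProbabilityMeasure D] (i : ℕ) {ε r : ℝ} (hε : 0 < ε)
    (hε1 : ε ≤ 1) {cut : Stick k R → Ω → (Fin (k - 1) → ℝ)} {status : Stick k R → Ω → Bool}
    (h : IsFragmentation μ D r cut status) :
    μ {ω | ∃ T : Finset (Stick k R), (∀ p, p ∈ T ↔ Alive (fun p => status p ω) p) ∧
        2 * ε * (leaves T).card ≤ ‖innovation χ L D i T (fun p => cut p ω)‖} ≤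
      4 * ENNReal.ofReal (Real.exp (-(ε ^ 2 / (4 * (2 * k * (k : ℝ) ^ i) ^ 2)) * R)) := by
  set q := 4 * ENNReal.ofReal (Real.exp (-(ε ^ 2 / (4 * (2 * k * (k : ℝ) ^ i) ^ 2)) * R)) with hq
  have hk1 : (1 : ℝ) ≤ k := by exact_mod_cast (by omega : 1 ≤ k)
  have hk0 : (0 : ℝ) < k := by linarith
  have hki : (1 : ℝ) ≤ (k : ℝ) ^ i := one_le_pow₀ hk1
  set A : Finset (Stick k R) → Set (Stick k R → Bool) := fun T => {a | ∀ p, p ∈ T ↔ Alive a p}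
  set B : Finset (Stick k R) → Set (Stick k R → (Fin (k - 1) → ℝ)) := fun T =>
    {c | 2 * ε * (leaves T).card ≤ ‖innovation χ L D i T c‖}
  have hA : ∀ T, MeasurableSet (A T) := fun T => by
    have : A T = ⋂ p, {a | p ∈ T ↔ Alive a p} := by ext; simp [A]
    rw [this]
    refine MeasurableSet.iInter fun p => ?_
    by_cases hp : p ∈ T
    · simpa only [hp, true_iff] using measurableSet_alive p
    · simpa only [hp, false_iff] using! (measurableSet_alive p).compl
  have hB : ∀ T, MeasurableSet (B T) := fun T =>
    measurableSet_le measurable_const (measurable_innovationSum L hχ D _ T).norm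
  have hmS : Measurable fun ω p => status p ω := measurable_pi_lambda _ h.measurable_status
  have hmC : Measurable fun ω p => cut p ω := measurable_pi_lambda _ h.measurable_cut
  have hset : {ω | ∃ T : Finset (Stick k R), (∀ p, p ∈ T ↔ Alive (fun p => status p ω) p) ∧
        2 * ε * (leaves T).card ≤ ‖innovation χ L D i T (fun p => cut p ω)‖} =
      ⋃ T, ((fun ω p => cut p ω) ⁻¹' B T ∩ (fun ω p => status p ω) ⁻¹' A T) := by
    ext ω
    simp only [Set.mem_ofPred_eq, Set.mem_iUnion, Set.mem_inter_iff, Set.mem_preimage, A, B]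
    exact exists_congr fun T => and_comm
  have hT : ∀ T, μ ((fun ω p => cut p ω) ⁻¹' B T ∩ (fun ω p => status p ω) ⁻¹' A T) ≤
      q * μ ((fun ω p => status p ω) ⁻¹' A T) := fun T => by
    rw [h.indep.measure_inter_preimage_eq_mul _ _ (hB T) (hA T)]
    -- Only a `T` realized by some statuses is closed under parents, which the Chernoff bound needs
    -- to compare `T.card` and `R` with the number of leaves.
    rcases Set.eq_empty_or_nonempty (A T) with he | ⟨a, ha⟩
    · simp [he]
    refine mul_le_mul_left ?_ _
    have hsub := subset_existing ha
    rw [← Measure.map_apply hmC (hB T), h.map_cut]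
    refine (measure_norm_innovationSum_ge_le L hχ hχ1 D _ (by omega) (K := (k : ℝ) ^ i)
      (fun u j => norm_leafWeight_le (fun j => ?_) i _) (by positivity) hε ?_ T
      (by exact_mod_cast card_le_card_leaves hk hsub)).trans ?_
    · simpa using norm_integral_le_of_norm_le_const (μ := D) (ae_of_all D fun x => hχ1 (gap x j))
    · nlinarith
    · rw [hq]
      have h2 : (R : ℝ) ≤ (leaves T).card := by exact_mod_cast le_card_leaves hk hsub
      have h3 : 0 ≤ ε ^ 2 / (4 * (2 * k * (k : ℝ) ^ i) ^ 2) := by positivity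
      refine mul_le_mul_right (ENNReal.ofReal_le_ofReal (Real.exp_le_exp.2 ?_)) 4
      rw [neg_mul, neg_mul, neg_le_neg_iff]
      exact mul_le_mul_of_nonneg_left h2 h3
  rw [hset]
  calc _ ≤ ∑' T, q * μ ((fun ω p => status p ω) ⁻¹' A T) :=
        (measure_iUnion_le _).trans (ENNReal.tsum_le_tsum hT)
    _ = q * μ (⋃ T, (fun ω p => status p ω) ⁻¹' A T) := by
        rw [ENNReal.tsum_mul_left, measure_iUnion _ fun T => hmS (hA T)]
        intro T T' hne
        rw [Function.onFun, Set.disjoint_left]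
        intro ω h1 h2
        exact hne (Finset.ext fun p => (h1 p).trans (h2 p).symm)
    _ ≤ q := mul_le_of_le_one_right' prob_le_one

lemma ae_eventually_innovation_lt (hk : 2 ≤ k) {χ : ℝ → ℂ} (hχ : Measurable χ)
    (hχ1 : ∀ x, ‖χ x‖ ≤ 1) (L : ℝ) [IsProbabilityMeasure D] {r : ℝ}
    (hproc : ∀ R, IsFragmentation μ D r (cut R) (status R)) :
    ∀ᵐ ω ∂μ, ∀ i m : ℕ, ∀ᶠ R in atTop, ∀ T : Finset (Stick k R),
      (∀ p, p ∈ T ↔ Alive (fun p => status R p ω) p) →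
        ‖innovation χ L D i T (fun p => cut R p ω)‖ < 1 / (m + 1 : ℝ) * (leaves T).card := by
  rw [ae_all_iff]
  intro i
  rw [ae_all_iff]
  intro m
  set ε : ℝ := 1 / (2 * (m + 1 : ℝ)) with hε
  have hε0 : 0 < ε := by positivity
  have hε1 : ε ≤ 1 := by
    rw [hε, div_le_one (by positivity)]
    have : (0 : ℝ) ≤ m := by positivity
    linarith
  set κ := ε ^ 2 / (4 * (2 * k * (k : ℝ) ^ i) ^ 2) with hκ
  have hκ0 : 0 < κ := by
    have : (0 : ℝ) < k := by positivity
    positivity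
  have hsum : ∑' R, μ {ω | ∃ T : Finset (Stick k R),
        (∀ p, p ∈ T ↔ Alive (fun p => status R p ω) p) ∧
        2 * ε * (leaves T).card ≤ ‖innovation χ L D i T (fun p => cut R p ω)‖} ≠ ∞ := by
    refine ne_top_of_le_ne_top ?_ (ENNReal.tsum_le_tsum fun R =>
      measure_innovation_ge_le hk hχ hχ1 L i hε0 hε1 (hproc R))
    rw [ENNReal.tsum_mul_left]
    refine ENNReal.mul_ne_top (by simp) ?_
    have hs : Summable fun R : ℕ => Real.exp (-κ * R) := by
      have := Real.summable_exp_nat_mul_iff.2 (neg_lt_zero.2 hκ0)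
      simpa only [mul_comm] using this
    rw [← ENNReal.ofReal_tsum_of_nonneg (fun R => (Real.exp_pos _).le) hs]
    exact ENNReal.ofReal_ne_top
  filter_upwards [ae_eventually_notMem hsum] with ω hω
  filter_upwards [hω] with R hR T hT
  by_contra! h
  refine hR ⟨T, hT, ?_⟩
  have : 2 * ε = 1 / (m + 1 : ℝ) := by rw [hε]; field_simp
  rwa [this]

end AlmostSure

/-! ### Weyl's criterion -/

section Weyl

instance isProbabilityMeasure_unitAddCircle :
    IsProbabilityMeasure (volume : Measure UnitAddCircle) := ⟨by simp⟩

lemma volume_unitAddCircle_singleton (x : UnitAddCircle) : volume ({x} : Set UnitAddCircle) = 0 := by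
  rw [← Metric.closedBall_zero, AddCircle.volume_closedBall]
  simp

/-- The arc of the circle that consists of the classes of the points of `[0, l]`. -/
def arc (l : ℝ) : Set UnitAddCircle := (fun x : ℝ => (x : UnitAddCircle)) '' Set.Icc 0 l

lemma coe_mem_arc {l : ℝ} (hl : l < 1) (y : ℝ) : (y : UnitAddCircle) ∈ arc l ↔ Int.fract y ≤ l := by
  constructor
  · rintro ⟨z, ⟨hz0, hzl⟩, hzy⟩
    have h1 : ((z - y : ℝ) : UnitAddCircle) = 0 := by
      rw [AddCircle.coe_sub, sub_eq_zero]; exact hzy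
    obtain ⟨m, hm⟩ := (AddCircle.coe_eq_zero_iff 1).1 h1
    have h2 : y = z + ((-m : ℤ) : ℝ) := by
      simp only [zsmul_eq_mul, mul_one] at hm
      push_cast; linarith
    rw [h2, Int.fract_add_intCast, Int.fract_eq_self.2 ⟨hz0, hzl.trans_lt hl⟩]
    exact hzl
  · intro h
    refine ⟨Int.fract y, ⟨Int.fract_nonneg y, h⟩, ?_⟩
    change ((Int.fract y : ℝ) : UnitAddCircle) = y
    rw [← sub_eq_zero, ← AddCircle.coe_sub, AddCircle.coe_eq_zero_iff]
    exact ⟨-⌊y⌋, by rw [Int.fract]; simp⟩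

lemma isClosed_arc (l : ℝ) : IsClosed (arc l) :=
  (isCompact_Icc.image (AddCircle.continuous_mk' 1)).isClosed

lemma volume_arc {l : ℝ} (h1 : l < 1) : volume (arc l) = ENNReal.ofReal l := by
  have hmp := UnitAddCircle.measurePreserving_mk 0
  rw [← hmp.measure_preimage (isClosed_arc l).measurableSet.nullMeasurableSet,
    ← Measure.restrict_congr_set Ico_ae_eq_Ioc,
    Measure.restrict_apply (hmp.measurable (isClosed_arc l).measurableSet)]
  have : (fun x : ℝ => (x : UnitAddCircle)) ⁻¹' arc l ∩ Set.Ico 0 (0 + 1) = Set.Icc 0 l := by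
    ext y
    simp only [Set.mem_inter_iff, Set.mem_preimage, coe_mem_arc h1, Set.mem_Ico, Set.mem_Icc,
      zero_add]
    constructor
    · rintro ⟨h, hy⟩
      rw [Int.fract_eq_self.2 hy] at h
      exact ⟨hy.1, h⟩
    · rintro ⟨hy0, hyl⟩
      have hy : 0 ≤ y ∧ y < 1 := ⟨hy0, hyl.trans_lt h1⟩
      rw [Int.fract_eq_self.2 hy]
      exact ⟨hyl, hy⟩
  rw [this, Real.volume_Icc, sub_zero]

/-- The quotient map is open, so the image of the open interval is interior and only the two
endpoint classes remain. -/
lemma volume_frontier_arc (l : ℝ) : volume (frontier (arc l)) = 0 := by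
  have hsub : frontier (arc l) ⊆ {((0 : ℝ) : UnitAddCircle)} ∪ {((l : ℝ) : UnitAddCircle)} := by
    intro x hx
    rw [(isClosed_arc l).frontier_eq] at hx
    obtain ⟨⟨y, hy, rfl⟩, hx⟩ := hx
    have hopen : IsOpen ((fun x : ℝ => (x : UnitAddCircle)) '' Set.Ioo 0 l) :=
      QuotientAddGroup.isOpenMap_coe _ isOpen_Ioo
    rcases hy.1.eq_or_lt with h | h
    · exact Or.inl (by simp [← h])
    rcases hy.2.eq_or_lt with h' | h'
    · exact Or.inr (by simp [h'])
    · exact absurd (interior_maximal (Set.image_mono Set.Ioo_subset_Icc_self) hopen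
        ⟨y, ⟨h, h'⟩, rfl⟩) hx
  exact measure_mono_null hsub (measure_union_null (volume_unitAddCircle_singleton _)
    (volume_unitAddCircle_singleton _))

lemma integral_fourier {n : ℤ} (hn : n ≠ 0) : ∫ x : UnitAddCircle, fourier n x = 0 :=
  integral_eq_zero_of_add_right_eq_neg (fourier_add_half_inv_index hn one_pos)

lemma norm_average_le {ι : Type*} (S : Finset ι) {f : ι → ℂ} {C : ℝ} (hC : 0 ≤ C)
    (hf : ∀ i, ‖f i‖ ≤ C) : ‖(∑ i ∈ S, f i) / S.card‖ ≤ C := by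
  rw [norm_div, Complex.norm_natCast]
  refine div_le_of_le_mul₀ (by positivity) hC ((norm_sum_le_of_le _ fun i _ => hf i).trans
    (le_of_eq ?_))
  simp [mul_comm]

variable {ι : ℕ → Type*} {S : ∀ R, Finset (ι R)} {θ : ∀ R, ι R → UnitAddCircle}

/-- Trigonometric polynomials are dense, and both the averages and the integral are `1`-Lipschitz
for the uniform norm. -/
lemma tendsto_average_continuousMap (hS : ∀ᶠ R in atTop, (S R).Nonempty)
    (h : ∀ n : ℤ, n ≠ 0 →
      Tendsto (fun R => (∑ p ∈ S R, (fourier n (θ R p) : ℂ)) / (S R).card) atTop (𝓝 0))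
    (f : C(UnitAddCircle, ℂ)) :
    Tendsto (fun R => (∑ p ∈ S R, f (θ R p)) / (S R).card) atTop (𝓝 (∫ x, f x)) := by
  have hspan : ∀ g ∈ Submodule.span ℂ (Set.range (@fourier 1)),
      Tendsto (fun R => (∑ p ∈ S R, g (θ R p)) / (S R).card) atTop (𝓝 (∫ x, g x)) := by
    intro g hg
    have hint : ∀ g : C(UnitAddCircle, ℂ), Integrable g := fun g =>
      g.continuous.integrable_of_hasCompactSupport (HasCompactSupport.of_compactSpace _)
    induction hg using Submodule.span_induction with
    | mem g hg =>
      obtain ⟨n, rfl⟩ := hg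
      by_cases hn : n = 0
      · subst hn
        simp only [fourier_zero, Finset.sum_const, nsmul_eq_mul, mul_one]
        have h1 : ∫ _x : UnitAddCircle, (1 : ℂ) = 1 := by
          rw [integral_const, probReal_univ, one_smul]
        rw [h1]
        refine tendsto_const_nhds.congr' ?_
        filter_upwards [hS] with R hR
        rw [div_self]
        exact_mod_cast hR.card_pos.ne'
      · rw [integral_fourier hn]
        exact h n hn
    | zero => simp
    | add g g' _ _ hg hg' =>
      simp only [ContinuousMap.add_apply, Finset.sum_add_distrib, add_div]
      rw [integral_add (hint g) (hint g')]
      exact hg.add hg'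
    | smul c g _ hg =>
      simp only [ContinuousMap.smul_apply, smul_eq_mul, ← Finset.mul_sum, mul_div_assoc]
      rw [integral_const_mul]
      exact hg.const_mul c
  rw [Metric.tendsto_nhds]
  intro ε hε
  have hf : f ∈ closure (Submodule.span ℂ (Set.range (@fourier 1)) : Set C(UnitAddCircle, ℂ)) := by
    rw [← Submodule.topologicalClosure_coe, span_fourier_closure_eq_top]
    trivial
  obtain ⟨g, hg, hfg⟩ := Metric.mem_closure_iff.1 hf (ε / 3) (by positivity)
  have hle : ∀ x, ‖f x - g x‖ ≤ dist f g := fun x => by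
    rw [← dist_eq_norm]; exact ContinuousMap.dist_apply_le_dist x
  have h2 : ‖(∫ x, g x) - ∫ x, f x‖ ≤ dist f g := by
    rw [← integral_sub, ← dist_zero_right]
    · have := norm_integral_le_of_norm_le_const (μ := (volume : Measure UnitAddCircle))
        (ae_of_all _ fun x => (norm_sub_rev (g x) (f x)).trans_le (hle x))
      rwa [probReal_univ, mul_one, ← dist_zero_right] at this
    all_goals
      exact (ContinuousMap.continuous _).integrable_of_hasCompactSupport
        (HasCompactSupport.of_compactSpace _)
  filter_upwards [(Metric.tendsto_nhds.1 (hspan g hg)) (ε / 3) (by positivity)] with R hR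
  have h1 := norm_average_le (S R) (f := fun p => f (θ R p) - g (θ R p)) dist_nonneg
    fun p => hle (θ R p)
  rw [Finset.sum_sub_distrib, sub_div] at h1
  rw [dist_eq_norm] at hR ⊢
  have h3 := norm_add₃_le (a := (∑ p ∈ S R, f (θ R p)) / ((S R).card : ℂ) -
      (∑ p ∈ S R, g (θ R p)) / ((S R).card : ℂ))
    (b := (∑ p ∈ S R, g (θ R p)) / ((S R).card : ℂ) - ∫ x, g x)
    (c := (∫ x, g x) - ∫ x, f x)
  rw [sub_add_sub_cancel, sub_add_sub_cancel] at h3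
  linarith

/-- The uniform distribution on the values of `t` at the points of `A`. -/
noncomputable def empirical {κ : Type*} (A : Finset κ) (t : κ → UnitAddCircle) :
    Measure UnitAddCircle :=
  (A.card : ℝ≥0∞)⁻¹ • ∑ p ∈ A, Measure.dirac (t p)

lemma isProbabilityMeasure_empirical {κ : Type*} {A : Finset κ} (hA : A.Nonempty)
    (t : κ → UnitAddCircle) : IsProbabilityMeasure (empirical A t) := ⟨by
  simp only [empirical, Measure.smul_apply, Measure.finsetSum_apply, measure_univ,
    Finset.sum_const, nsmul_eq_mul, mul_one, smul_eq_mul]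
  exact ENNReal.inv_mul_cancel (by exact_mod_cast hA.card_pos.ne') (ENNReal.natCast_ne_top _)⟩

open Classical in
lemma toReal_empirical {κ : Type*} (A : Finset κ) (t : κ → UnitAddCircle)
    {E : Set UnitAddCircle} (hE : MeasurableSet E) :
    (empirical A t E).toReal = ({p ∈ A | t p ∈ E}.card : ℝ) / A.card := by
  simp only [empirical, Measure.smul_apply, Measure.finsetSum_apply, Measure.dirac_apply' _ hE,
    Set.indicator_apply, Pi.one_apply, smul_eq_mul]
  rw [Finset.sum_boole, ENNReal.toReal_mul, ENNReal.toReal_inv, ENNReal.toReal_natCast,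
    ENNReal.toReal_natCast, div_eq_inv_mul]

lemma integral_empirical {κ : Type*} (A : Finset κ) (t : κ → UnitAddCircle)
    (f : UnitAddCircle → ℂ) : ∫ x, f x ∂(empirical A t) = (∑ p ∈ A, f (t p)) / A.card := by
  rw [empirical, integral_smul_measure, integral_finsetSum_measure]
  · simp [integral_dirac, div_eq_inv_mul]
  · exact fun p _ => integrable_dirac (by simp)

open Classical in
/-- Weyl's criterion for triangular arrays. -/
lemma tendsto_proportion_arc (hS : ∀ᶠ R in atTop, (S R).Nonempty)
    (h : ∀ n : ℤ, n ≠ 0 →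
      Tendsto (fun R => (∑ p ∈ S R, (fourier n (θ R p) : ℂ)) / (S R).card) atTop (𝓝 0))
    {l : ℝ} (h0 : 0 ≤ l) (h1 : l < 1) :
    Tendsto (fun R => ({p ∈ S R | θ R p ∈ arc l}.card : ℝ) / (S R).card) atTop (𝓝 l) := by
  set V : ProbabilityMeasure UnitAddCircle := ⟨volume, isProbabilityMeasure_unitAddCircle⟩ with hV
  set P : ℕ → ProbabilityMeasure UnitAddCircle := fun R =>
    if hR : (S R).Nonempty then ⟨empirical (S R) (θ R), isProbabilityMeasure_empirical hR _⟩
    else V with hP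
  have hPe : ∀ᶠ R in atTop, (P R : Measure UnitAddCircle) = empirical (S R) (θ R) := by
    filter_upwards [hS] with R hR
    simp [hP, hR]
  have hlim : Tendsto P atTop (𝓝 V) := by
    rw [ProbabilityMeasure.tendsto_iff_forall_integral_rclike_tendsto ℂ]
    intro f
    refine (tendsto_average_continuousMap hS h f.toContinuousMap).congr' ?_
    filter_upwards [hPe] with R hR
    rw [hR, integral_empirical]
    rfl
  have h2 := ProbabilityMeasure.tendsto_measure_of_null_frontier_of_tendsto' hlim
    (E := arc l) (volume_frontier_arc l)
  have h3 := (ENNReal.tendsto_toReal (measure_ne_top _ _)).comp h2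
  simp only [hV, ProbabilityMeasure.coe_mk, volume_arc h1, ENNReal.toReal_ofReal h0] at h3
  refine h3.congr' ?_
  filter_upwards [hPe] with R hR
  rw [Function.comp_apply, hR, toReal_empirical _ _ (isClosed_arc l).measurableSet]

end Weyl

/-! ### Significands -/

section Significand

variable {B : ℝ}

lemma significand_eq (hB : 1 < B) {x : ℝ} (hx : 0 < x) :
    significand B x = B ^ Int.fract (Real.logb B x) := by
  have hB0 : 0 < B := by linarith
  rw [significand, Int.fract, Real.rpow_sub hB0, Real.rpow_logb hB0 hB.ne' hx, Real.rpow_intCast]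

lemma significand_mem_iff (hB : 1 < B) {x s : ℝ} (hx : 0 < x) (hs : s ∈ Set.Ico 1 B) :
    (1 ≤ significand B x ∧ significand B x ≤ s) ↔
      ((Real.logb B x : ℝ) : UnitAddCircle) ∈ arc (Real.logb B s) := by
  have hs0 : 0 < s := by linarith [hs.1]
  have hl : Real.logb B s < 1 := by
    rw [Real.logb_lt_iff_lt_rpow hB hs0, Real.rpow_one]; exact hs.2
  rw [coe_mem_arc hl, significand_eq hB hx, Real.le_logb_iff_rpow_le hB hs0]
  exact and_iff_right (Real.one_le_rpow hB.le (Int.fract_nonneg _))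

lemma measurable_significand (B : ℝ) : Measurable (significand B) := by
  have h1 : Measurable (Real.logb B) := Real.measurable_log.div_const _
  have h2 : Measurable fun x : ℝ => B ^ ⌊Real.logb B x⌋ :=
    (measurable_from_top (f := fun n : ℤ => B ^ n)).comp h1.floor
  exact measurable_id.div h2

end Significand

/-! ### Proportions among the ending sticks -/

section Proportion

variable {k R : ℕ} {L B s : ℝ} {a : Stick k R → Bool} {c : Stick k R → (Fin (k - 1) → ℝ)}
  {T : Finset (Stick k R)}

open Classical in
lemma significandProportion_endingLength (hB : 1 < B) (hL : 0 < L)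
    (hc : ∀ u (j : Fin k), 0 < gap (c u) j) (hT : ∀ p, p ∈ T ↔ Alive a p)
    (hs : s ∈ Set.Ico 1 B) :
    significandProportion B s (endingLength L c a) =
      ({p ∈ leaves T |
        ((Real.logb B (len L c p) : ℝ) : UnitAddCircle) ∈ arc (Real.logb B s)}.card : ℝ) /
        (leaves T).card := by
  rw [significandProportion]
  congr 2
  · rw [← Nat.subtype_card (p := fun p => IsDead (fun u => a (p.1, u)) p.2 ∧
      (1 ≤ significand B (len L c p) ∧ significand B (len L c p) ≤ s))]
    · exact Nat.card_congr (Equiv.subtypeSubtypeEquivSubtypeInter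
        (fun p : Stick k R => IsDead (fun u => a (p.1, u)) p.2)
        (fun p => 1 ≤ significand B (len L c p) ∧ significand B (len L c p) ≤ s))
    · intro p
      rw [Finset.mem_filter, isDead_iff hT, significand_mem_iff hB (len_pos hL hc p) hs]
  · exact Nat.subtype_card _ fun p => (isDead_iff hT p).symm

lemma finite_endingStick (h : Terminates a) : Finite (EndingStick a) := by
  obtain ⟨T, hT⟩ := exists_aliveTree h
  exact Set.Finite.to_subtype ((leaves T).finite_toSet.subset fun p hp => (isDead_iff hT p).1 hp)

lemma significandProportion_mem_Icc (B s : ℝ) {ι : Type*} (x : ι → ℝ) :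
    significandProportion B s x ∈ Set.Icc (0 : ℝ) 1 := by
  refine ⟨by unfold significandProportion; positivity, ?_⟩
  rw [significandProportion]
  rcases finite_or_infinite ι with h | h
  · exact div_le_one_of_le₀ (by exact_mod_cast Finite.card_subtype_le _) (by positivity)
  -- `Nat.card` of an infinite type is `0`, so the proportion is `0` by division by zero.
  · simp

lemma measurable_natCard {Ω κ : Type*} [MeasurableSpace Ω] [Countable κ] {Q : Ω → κ → Prop}
    (hQ : ∀ p, MeasurableSet {ω | Q ω p}) :
    Measurable fun ω => (Nat.card {p // Q ω p} : ℝ) := by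
  classical
  have h : (fun ω => (Nat.card {p // Q ω p} : ℝ)) =
      fun ω => (∑' p, if Q ω p then (1 : ℝ≥0∞) else 0).toReal := by
    ext ω
    have h1 : (∑' p, if Q ω p then (1 : ℝ≥0∞) else 0) = ({p | Q ω p} : Set κ).encard := by
      rw [← ENNReal.tsum_set_one, tsum_subtype {p | Q ω p} fun _ => (1 : ℝ≥0∞)]
      exact tsum_congr fun p => by simp [Set.indicator_apply]
    rw [h1]
    rcases Set.finite_or_infinite {p | Q ω p} with hf | hf
    · rw [hf.encard_eq_coe_toFinset_card, ENat.toENNReal_coe, ENNReal.toReal_natCast]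
      congr 1
      exact Nat.subtype_card _ fun p => by simp
    -- Both conventions give `0` for an infinite count: `Nat.card` on one side, `ENNReal.toReal ∞`
    -- on the other.
    · rw [hf.encard_eq]
      have : Infinite {p // Q ω p} := hf.to_subtype
      simp
  rw [h]
  exact (Measurable.tsum fun p =>
    Measurable.ite (hQ p) measurable_const measurable_const).ennreal_toReal

lemma measurable_significandProportion {Ω : Type*} [MeasurableSpace Ω] {μ : Measure Ω}
    {D : Measure (Fin (k - 1) → ℝ)} {r : ℝ} {cut : Stick k R → Ω → (Fin (k - 1) → ℝ)}
    {status : Stick k R → Ω → Bool} (h : IsFragmentation μ D r cut status) (L B s : ℝ) :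
    Measurable fun ω => significandProportion B s
      (endingLength L (fun p => cut p ω) (fun p => status p ω)) := by
  have hmS : Measurable fun ω p => status p ω := measurable_pi_lambda _ h.measurable_status
  have hmC : Measurable fun ω p => cut p ω := measurable_pi_lambda _ h.measurable_cut
  have hdead : ∀ p : Stick k R,
      MeasurableSet {ω | IsDead (fun u => status (p.1, u) ω) p.2} := fun p => by
    cases p using stick_induction with
    | root i => exact MeasurableSet.empty
    | step u j =>
      exact (hmS (measurableSet_alive u)).inter
        (measurableSet_eq_fun (h.measurable_status (child u j)) measurable_const)
  have hsig : ∀ p : Stick k R, Measurable fun ω => significand B (len L (fun q => cut q ω) p) :=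
    fun p => (measurable_significand B).comp ((measurable_len L p).comp hmC)
  refine Measurable.div ?_ (measurable_natCard hdead)
  have hcard : ∀ ω, Nat.card {i : EndingStick (fun p => status p ω) //
      1 ≤ significand B (endingLength L (fun p => cut p ω) (fun p => status p ω) i) ∧
      significand B (endingLength L (fun p => cut p ω) (fun p => status p ω) i) ≤ s} =
      Nat.card {p : Stick k R // IsDead (fun u => status (p.1, u) ω) p.2 ∧
        1 ≤ significand B (len L (fun q => cut q ω) p) ∧
        significand B (len L (fun q => cut q ω) p) ≤ s} := fun ω =>
    Nat.card_congr (Equiv.subtypeSubtypeEquivSubtypeInter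
      (fun p : Stick k R => IsDead (fun u => status (p.1, u) ω) p.2)
      (fun p => 1 ≤ significand B (len L (fun q => cut q ω) p) ∧
        significand B (len L (fun q => cut q ω) p) ≤ s))
  simp only [hcard]
  exact measurable_natCard fun p => (hdead p).inter
    ((measurableSet_le measurable_const (hsig p)).inter (measurableSet_le (hsig p) measurable_const))

end Proportion

/-- Almost sure convergence to Benford behavior implies convergence of means and variances. -/
lemma convergesToStrongBenfordInMean_of_ae {B : ℝ} {Ω : Type*} [MeasurableSpace Ω]
    {μ : Measure Ω} [IsProbabilityMeasure μ] {ι : ℕ → Ω → Type*} {X : ∀ n ω, ι n ω → ℝ}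
    (hX : ∀ n s, Measurable fun ω => significandProportion B s (X n ω))
    (h : ∀ᵐ ω ∂μ, ConvergesToStrongBenford B fun n => X n ω) :
    ConvergesToStrongBenfordInMean B μ X := by
  have hmean : ∀ s ∈ Set.Ico 1 B, Tendsto (fun n => ∫ ω, significandProportion B s (X n ω) ∂μ)
      atTop (𝓝 (Real.logb B s)) := fun s hs => by
    have h1 := tendsto_integral_of_dominated_convergence (μ := μ) (f := fun _ => Real.logb B s)
      (fun _ => (1 : ℝ)) (fun n => (hX n s).aestronglyMeasurable) (integrable_const _)
      (fun n => ae_of_all _ fun ω => by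
        have := significandProportion_mem_Icc B s (X n ω)
        rw [Real.norm_of_nonneg this.1]; exact this.2)
      (h.mono fun ω hω => hω.tendsto s hs)
    simpa using h1
  refine ⟨hmean, fun s hs => ?_⟩
  have hsq : Tendsto (fun n => ∫ ω, significandProportion B s (X n ω) ^ 2 ∂μ)
      atTop (𝓝 (Real.logb B s ^ 2)) := by
    have h1 := tendsto_integral_of_dominated_convergence (μ := μ)
      (F := fun n ω => significandProportion B s (X n ω) ^ 2) (f := fun _ => Real.logb B s ^ 2)
      (fun _ => (1 : ℝ)) (fun n => ((hX n s).pow_const 2).aestronglyMeasurable)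
      (integrable_const _)
      (fun n => ae_of_all _ fun ω => by
        have := significandProportion_mem_Icc B s (X n ω)
        rw [Real.norm_of_nonneg (sq_nonneg _)]
        exact pow_le_one₀ this.1 this.2)
      (h.mono fun ω hω => (hω.tendsto s hs).pow 2)
    simpa using h1
  have hvar : ∀ n, variance (fun ω => significandProportion B s (X n ω)) μ =
      (∫ ω, significandProportion B s (X n ω) ^ 2 ∂μ) -
        (∫ ω, significandProportion B s (X n ω) ∂μ) ^ 2 := fun n => by
    refine variance_eq_sub (MemLp.of_bound (hX n s).aestronglyMeasurable 1
      (ae_of_all _ fun ω => ?_))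
    have := significandProportion_mem_Icc B s (X n ω)
    rw [Real.norm_of_nonneg this.1]; exact this.2
  simp only [hvar]
  simpa using hsq.sub ((hmean s hs).pow 2)

end StickFragmentation

theorem mainTheorem4 (k : ℕ) (hk : 2 ≤ k) (L : ℝ) (hL : 0 < L) (B : ℝ) (hB : 1 < B)
    (D : Measure (Fin (k - 1) → ℝ)) (hD : IsGood D)
    {Ω : Type*} [MeasurableSpace Ω] (μ : Measure Ω) [IsProbabilityMeasure μ]
    (cut : ∀ R : ℕ, Stick k R → Ω → (Fin (k - 1) → ℝ))
    (status : ∀ R : ℕ, Stick k R → Ω → Bool)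
    (hproc : ∀ R : ℕ, IsFragmentation μ D (1 / (k : ℝ)) (cut R) (status R)) :
    (∀ R : ℕ, ∀ᵐ ω ∂μ, Terminates (fun p => status R p ω)) ∧
    (∀ᵐ ω ∂μ, ConvergesToStrongBenford B
      (fun R => endingLength L (fun p => cut R p ω) (fun p => status R p ω))) ∧
    ConvergesToStrongBenfordInMean B μ
      (fun R ω => endingLength L (fun p => cut R p ω) (fun p => status R p ω)) := by
  have hDp := hD.isProbabilityMeasure
  have hterm : ∀ R : ℕ, ∀ᵐ ω ∂μ, Terminates (fun p => status R p ω) := fun R =>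
    (hproc R).ae_terminates hk
  have hmain : ∀ᵐ ω ∂μ, ConvergesToStrongBenford B
      (fun R => endingLength L (fun p => cut R p ω) (fun p => status R p ω)) := by
    have hgap : ∀ᵐ ω ∂μ, ∀ R u (j : Fin k), 0 < gap (cut R u ω) j :=
      ae_all_iff.2 fun R => (hproc R).ae_gap_pos hD
    have hinn : ∀ᵐ ω ∂μ, ∀ (n : ℤ) (i m : ℕ), ∀ᶠ R in atTop, ∀ T : Finset (Stick k R),
        (∀ p, p ∈ T ↔ Alive (fun p => status R p ω) p) →
          ‖innovation (logChar B n) L D i T (fun p => cut R p ω)‖ <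
            1 / (m + 1 : ℝ) * (leaves T).card :=
      ae_all_iff.2 fun n => ae_eventually_innovation_lt hk measurable_logChar
        (fun x => (norm_logChar x).le) L hproc
    -- All exceptional events are indexed by countable families, so one null set is discarded and
    -- the rest is deterministic.
    filter_upwards [ae_all_iff.2 hterm, hgap, hinn, ae_eventually_lt_aliveCount hk hproc]
      with ω hω hg hI hA
    choose T hT using fun R => exists_aliveTree (hω R)
    have hN := tendsto_div_card_leaves hk hT hA
    have hchar : ∀ n : ℤ, n ≠ 0 → Tendsto (fun R => (∑ p ∈ leaves (T R),
        (fourier n ((Real.logb B (len L (fun p => cut R p ω) p) : ℝ) : UnitAddCircle) : ℂ)) /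
          (leaves (T R)).card) atTop (𝓝 0) := fun n hn => by
      have h := tendsto_average_stickProd (L := L) (c := fun R p => cut R p ω) (D := D) hk hT hN
        (fun x => (norm_logChar (B := B) (n := n) x).le)
        (fun j => norm_integral_logChar_lt_one D hB hn (hD.ae_gap_pos (by have := j.2; omega))
          fun t => hD.measure_gap_eq (by have := j.2; omega) t)
        (fun i m => (hI n i m).mono fun R hR => hR (T R) (hT R))
      refine h.congr fun R => ?_
      simp only [stickProd_logChar hL (hg R)]
      rfl
    refine ⟨fun R => finite_endingStick (hω R), fun R p => len_pos hL (hg R) p.1, fun s hs => ?_⟩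
    have hne : ∀ᶠ R in atTop, (leaves (T R)).Nonempty := by
      filter_upwards [eventually_gt_atTop 0] with R hR
      exact Finset.card_pos.1 (hR.trans_le (le_card_leaves hk (subset_existing (hT R))))
    have h := tendsto_proportion_arc hne hchar (l := Real.logb B s)
      (Real.logb_nonneg hB hs.1)
      (by rw [Real.logb_lt_iff_lt_rpow hB (by linarith [hs.1]), Real.rpow_one]; exact hs.2)
    exact h.congr fun R => (significandProportion_endingLength hB hL (hg R) (hT R) hs).symm
  exact ⟨hterm, hmain, convergesToStrongBenfordInMean_of_ae
    (fun R s => measurable_significandProportion (hproc R) L B s) hmain⟩
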